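/- Let $\mathcal H$ be a separable complex Hilbert space, let $J$ be a (possibly unbounded) skew-adjoint operator in $\mathcal H$ ($J^*=-J$) and let $R$ be a (possibly unbounded) non-negative self-adjoint operator in $\mathcal H$ ($R^*=R\ge 0$), with non-negative self-adjoint square root $R^{1/2}$. Assume that either $J$ is $R$-bounded with $R$-bound smaller than one, or $R$ is $J$-bounded with $J$-bound smaller than one. Here, $S$ is called $L$-bounded with $L$-bound smaller than one if $\operatorname{dom}L\subset\operatorname{dom}S$ and there are $0\le a<1$ and $b\ge 0$ with $\|Sx\|\le a\|Lx\|+b\|x\|$ for all $x\in\operatorname{dom}L$. Let $B:\mathbb C^m\to\mathcal H$ be linear and bounded, let $T>0$, and set $H(x):=\tfrac12\|x\|^2$. Then $A:=J-R$, defined on $\operatorname{dom}J\cap\operatorname{dom}R$, generates a $C_0$-semigroup of contractions $(\mathcal T(t))_{t\ge 0}$ on $\mathcal H$, and the following holds. For every $x_0\in\mathcal H$ and every $u\in L^1(0,T;\mathbb C^m)$ the mild solution $$x(t)=\mathcal T(t)x_0+\int_0^t\mathcal T(t-s)Bu(s)\,ds,\qquad t\in[0,T],$$ of $\dot x=Ax+Bu$,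 $x(0)=x_0$, satisfies $x(t)\in\operatorname{dom}R^{1/2}$ for a.e. $t\in[0,T]$ and $R^{1/2}x\in L^2(0,T;\mathcal H)$; moreover $\operatorname{Re}\langle Bu,x\rangle\in L^1(0,T)$ and $$\int_0^T\operatorname{Re}\langle Bu(t),x(t)\rangle\,dt = H(x(T))-H(x(0))+\int_0^T\|R^{1/2}x(t)\|^2\,dt.$$ In particular, for every $x_0\in\mathcal H$, $\mathcal T(t)x_0\in\operatorname{dom}R^{1/2}$ for a.e. $t>0$, and $R^{1/2}\mathcal T(\cdot)x_0\in L^2(0,T;\mathcal H)$. -/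

import Mathlib

open MeasureTheory Set Filter Topology
open scoped InnerProductSpace

noncomputable section

namespace PortHamiltonian

variable {E : Type*} [NormedAddCommGroup E] [InnerProductSpace ℂ E]

/-- The (possibly unbounded, densely defined) operator `J` satisfies `J* = -J`,
equality of domains included. -/
def IsSkewAdjoint [CompleteSpace E] (J : E →ₗ.[ℂ] E) : Prop :=
  Dense (J.domain : Set E) ∧ J.adjoint = -J

/-- `R* = R ≥ 0` for a (possibly unbounded, densely defined) operator `R`. -/
def IsNonnegSelfAdjoint [CompleteSpace E] (R : E →ₗ.[ℂ] E) : Prop :=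
  Dense (R.domain : Set E) ∧ R.adjoint = R ∧
    ∀ x : R.domain, 0 ≤ (⟪R x, (x : E)⟫_ℂ).re

/-- `S` is `L`-bounded with `L`-bound smaller than one: `dom L ⊆ dom S`, and the infimum of all
`a ≥ 0` for which there is `b ≥ 0` with `‖S x‖ ≤ a ‖L x‖ + b ‖x‖` on `dom L` is below one. -/
def IsRelBoundedLTOne (S L : E →ₗ.[ℂ] E) : Prop :=
  ∃ h : L.domain ≤ S.domain, ∃ a b : ℝ, 0 ≤ a ∧ a < 1 ∧ 0 ≤ b ∧
    ∀ x : L.domain, ‖S ⟨x, h x.2⟩‖ ≤ a * ‖L x‖ + b * ‖(x : E)‖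

/-- `S` is a non-negative self-adjoint operator with `S² = R`, where `S²` has its natural domain
`{x ∈ dom S : S x ∈ dom S}`. -/
def IsPosSqrt [CompleteSpace E] (R S : E →ₗ.[ℂ] E) : Prop :=
  IsNonnegSelfAdjoint S ∧
    ∀ x y : E, (x, y) ∈ R.graph ↔ ∃ z : E, (x, z) ∈ S.graph ∧ (z, y) ∈ S.graph

/-- `R^{1/2}`: the non-negative self-adjoint square root of `R`. -/
def posSqrt [CompleteSpace E] (R : E →ₗ.[ℂ] E) : E →ₗ.[ℂ] E :=
  Classical.epsilon (IsPosSqrt R)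

open Classical in
/-- The value `S x` of a partially defined operator for `x ∈ dom S` (and `0` elsewhere). -/
def eval (S : E →ₗ.[ℂ] E) (x : E) : E :=
  if h : x ∈ S.domain then S ⟨x, h⟩ else 0

/-- A strongly continuous semigroup of bounded operators `(𝒯 t)_{t ≥ 0}`; the values of `𝒯` at
negative times are irrelevant. -/
structure IsC0Semigroup (𝒯 : ℝ → E →L[ℂ] E) : Prop where
  zero : 𝒯 0 = ContinuousLinearMap.id ℂ E
  add : ∀ s t : ℝ, 0 ≤ s → 0 ≤ t → 𝒯 (s + t) = (𝒯 s).comp (𝒯 t)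
  tendsto : ∀ x : E, Tendsto (fun t : ℝ => 𝒯 t x) (𝓝[>] 0) (𝓝 x)

/-- `A` is the infinitesimal generator of `𝒯`: `x ∈ dom A` and `A x = y` if and only if
`(𝒯 t x - x) / t → y` as `t ↓ 0`. -/
def IsGenerator (A : E →ₗ.[ℂ] E) (𝒯 : ℝ → E →L[ℂ] E) : Prop :=
  ∀ x y : E, (x, y) ∈ A.graph ↔
    Tendsto (fun t : ℝ => (t : ℂ)⁻¹ • (𝒯 t x - x)) (𝓝[>] 0) (𝓝 y)

/-- The `C₀`-semigroup generated by `A`. -/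
def semigroup (A : E →ₗ.[ℂ] E) : ℝ → E →L[ℂ] E :=
  Classical.epsilon fun 𝒯 => IsC0Semigroup 𝒯 ∧ IsGenerator A 𝒯

/-- The mild solution `x(t; x₀, u) = 𝒯(t) x₀ + ∫₀ᵗ 𝒯(t - s) B u(s) ds` of `x' = A x + B u`,
`x(0) = x₀`, where `𝒯` is the semigroup generated by `A`. -/
def mildSolution {m : ℕ} (A : E →ₗ.[ℂ] E) (B : EuclideanSpace ℂ (Fin m) →L[ℂ] E)
    (x₀ : E) (u : ℝ → EuclideanSpace ℂ (Fin m)) (t : ℝ) : E :=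
  semigroup A t x₀ + ∫ s in (0 : ℝ)..t, semigroup A (t - s) (B (u s))

/-- The energy Hamiltonian `H(x) = ½ ‖x‖²`. -/
def hamiltonian (x : E) : ℝ := 1 / 2 * ‖x‖ ^ 2

end PortHamiltonian

end

open PortHamiltonian

/-! If `z' = A z + g` classically, then `d/dt ½‖z‖² = Re ⟨A z, z⟩ + Re ⟨g, z⟩`. Here `Re ⟨A z, z⟩ =
-‖R^{1/2} z‖²`, since `J` contributes only an imaginary part. Integration gives the energy balance
(`IsRegularSolution.energy`).

A mild solution need not lie in `dom A`, so it is regularised: `f = B u` is approximated in `L¹` by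
continuous functions, and the resulting solution is multiplied by `lam (lam - A)⁻¹`, which maps into
`dom A`, commutes with the semigroup and tends strongly to the identity. The balance for the
difference of two regularisations bounds `∫ ‖R^{1/2} (zₙ - zₘ)‖²` by differences of initial values
and forcings, so `R^{1/2} zₙ` is Cauchy in `L²`. As `R^{1/2}` is closed, the limit is `R^{1/2} x`,
and every term of the balance converges (`IsContractionSemigroup.energy_duhamel`).

For the generator, `lam - J` and `lam + R` are onto for all `lam > 0`: dissipativity makes the range
closed, (skew-)self-adjointness makes it dense. A Neumann series carries this over to `lam - (J -
R)` for large `lam` (`exists_isResolvent_sub`), and Yosida approximation produces the semigroup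
(`exists_isC0Semigroup`). The square root is built from the bounded operator `K = (1 + R)⁻¹` as `√(1
- K) (√K)⁻¹` (`IsNonnegSelfAdjoint.exists_isPosSqrt`). -/

noncomputable section

namespace PortHamiltonian

variable {E : Type*} [NormedAddCommGroup E] [InnerProductSpace ℂ E]

/-! ### Dissipative operators, graphs and resolvents. -/

/-- `Re ⟨A x, x⟩ ≤ 0` on `dom A`. -/
def IsDissipative (A : E →ₗ.[ℂ] E) : Prop :=
  ∀ x y : E, (x, y) ∈ A.graph → (⟪y, x⟫_ℂ).re ≤ 0

/-- `G` is the bounded inverse of `lam - A`. -/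
def IsResolvent (A : E →ₗ.[ℂ] E) (lam : ℝ) (G : E →L[ℂ] E) : Prop :=
  ∀ x y : E, (x, y) ∈ A.graph ↔ G ((lam : ℂ) • x - y) = x

theorem norm_smul_sub_sq (lam : ℝ) (x y : E) :
    ‖(lam : ℂ) • x - y‖ ^ 2 = lam ^ 2 * ‖x‖ ^ 2 - 2 * lam * (⟪y, x⟫_ℂ).re + ‖y‖ ^ 2 := by
  have h := norm_sub_sq (𝕜 := ℂ) ((lam : ℂ) • x) y
  have h2 : (⟪x, y⟫_ℂ).re = (⟪y, x⟫_ℂ).re := inner_re_symm (𝕜 := ℂ) x y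
  rw [h, inner_smul_left, norm_smul]
  simp [mul_pow, h2]
  ring

theorem re_inner_real_smul_self (c : ℝ) (x : E) : (⟪(c : ℂ) • x, x⟫_ℂ).re = c * ‖x‖ ^ 2 := by
  rw [inner_smul_left, inner_self_eq_norm_sq_to_K]
  simp [← Complex.ofReal_pow]

theorem norm_smul_le_norm_smul_sub {lam : ℝ} (hl : 0 ≤ lam) {x y : E} (h : (⟪y, x⟫_ℂ).re ≤ 0) :
    lam * ‖x‖ ≤ ‖(lam : ℂ) • x - y‖ := by
  have := norm_smul_sub_sq lam x y
  refine le_of_sq_le_sq ?_ (norm_nonneg _)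
  rw [this]
  nlinarith [mul_nonneg hl (neg_nonneg.mpr h), sq_nonneg ‖y‖]

theorem norm_le_norm_smul_sub {lam : ℝ} (hl : 0 ≤ lam) {x y : E} (h : (⟪y, x⟫_ℂ).re ≤ 0) :
    ‖y‖ ≤ ‖(lam : ℂ) • x - y‖ := by
  have := norm_smul_sub_sq lam x y
  refine le_of_sq_le_sq ?_ (norm_nonneg _)
  rw [this]
  nlinarith [mul_nonneg hl (neg_nonneg.mpr h), mul_nonneg (sq_nonneg lam) (sq_nonneg ‖x‖)]

theorem mem_graph_neg {A : E →ₗ.[ℂ] E} {x y : E} : (x, y) ∈ (-A).graph ↔ (x, -y) ∈ A.graph := by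
  simp only [LinearPMap.mem_graph_iff, LinearPMap.neg_apply, LinearPMap.neg_domain,
    neg_eq_iff_eq_neg]

theorem mem_graph_sub {A B : E →ₗ.[ℂ] E} {x y : E} :
    (x, y) ∈ (A - B).graph ↔ ∃ z w, (x, z) ∈ A.graph ∧ (x, w) ∈ B.graph ∧ y = z - w := by
  constructor
  · intro h
    obtain ⟨v, hv, hy⟩ := (LinearPMap.mem_graph_iff _).1 h
    obtain ⟨v, h1, h2⟩ := v
    simp only at hv hy
    subst hv
    exact ⟨A ⟨v, h1⟩, B ⟨v, h2⟩, A.mem_graph ⟨v, h1⟩, B.mem_graph ⟨v, h2⟩, hy.symm⟩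
  · rintro ⟨z, w, hz, hw, rfl⟩
    obtain ⟨⟨a, ha⟩, rfl, rfl⟩ := (LinearPMap.mem_graph_iff _).1 hz
    obtain ⟨⟨b, hb⟩, hab, rfl⟩ := (LinearPMap.mem_graph_iff _).1 hw
    simp only at hab
    subst hab
    exact (LinearPMap.mem_graph_iff _).2 ⟨⟨b, ha, hb⟩, rfl, rfl⟩

theorem IsResolvent.mem_graph {A : E →ₗ.[ℂ] E} {lam : ℝ} {G : E →L[ℂ] E}
    (hG : IsResolvent A lam G) (v : E) : (G v, (lam : ℂ) • G v - v) ∈ A.graph := by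
  rw [hG]; simp

/-- The inequality `lam ‖x‖ ≤ ‖lam x - A x‖` makes `lam - A` injective, hence its inverse linear,
and bounds that inverse by `1 / lam`. -/
theorem exists_isResolvent {A : E →ₗ.[ℂ] E} (hA : IsDissipative A) {lam : ℝ} (hl : 0 < lam)
    (hs : ∀ v, ∃ x y, (x, y) ∈ A.graph ∧ (lam : ℂ) • x - y = v) :
    ∃ G : E →L[ℂ] E, IsResolvent A lam G := by
  have huniq : ∀ x y x' y', (x, y) ∈ A.graph → (x', y') ∈ A.graph →
      (lam : ℂ) • x - y = (lam : ℂ) • x' - y' → x = x' := by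
    intro x y x' y' h h' he
    have h1 : (x - x', y - y') ∈ A.graph := A.graph.sub_mem h h'
    have h2 := norm_smul_le_norm_smul_sub hl.le (hA _ _ h1)
    have h3 : (lam : ℂ) • (x - x') - (y - y') = 0 := by
      rw [smul_sub, sub_sub_sub_comm, he, sub_self]
    rw [h3, norm_zero] at h2
    have : ‖x - x'‖ ≤ 0 := by
      by_contra hc
      push Not at hc
      nlinarith [mul_pos hl hc]
    exact sub_eq_zero.1 (norm_le_zero_iff.1 this)
  choose g k hg hk using hs
  let G₀ : E →ₗ[ℂ] E :=
    { toFun := g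
      map_add' := fun v w => by
        refine huniq _ _ _ _ (hg _) (A.graph.add_mem (hg v) (hg w)) ?_
        rw [hk, smul_add, add_sub_add_comm, hk, hk]
      map_smul' := fun c v => by
        refine huniq _ _ _ _ (hg _) (A.graph.smul_mem c (hg v)) ?_
        simp only [RingHom.id_apply]
        rw [hk, smul_comm, ← smul_sub, hk] }
  let G : E →L[ℂ] E := G₀.mkContinuous lam⁻¹ (fun v => by
    have h := norm_smul_le_norm_smul_sub hl.le (hA _ _ (hg v))
    rw [hk] at h
    rw [inv_mul_eq_div, le_div_iff₀ hl, mul_comm]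
    exact h)
  have hGg : ∀ v, G v = g v := fun v => rfl
  refine ⟨G, fun x y => ⟨fun h => ?_, fun h => ?_⟩⟩
  · rw [hGg]
    exact huniq _ _ _ _ (hg _) h (hk _)
  · rw [hGg] at h
    have h1 := hg ((lam : ℂ) • x - y)
    have h2 := hk ((lam : ℂ) • x - y)
    rw [h] at h1 h2
    rwa [sub_right_inj.1 h2] at h1

theorem IsResolvent.norm_apply_le {A : E →ₗ.[ℂ] E} (hA : IsDissipative A) {lam : ℝ}
    (hl : 0 ≤ lam) {G : E →L[ℂ] E} (hG : IsResolvent A lam G) (v : E) : lam * ‖G v‖ ≤ ‖v‖ := by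
  simpa using norm_smul_le_norm_smul_sub hl (hA _ _ (hG.mem_graph v))

theorem isClosed_graph_neg {A : E →ₗ.[ℂ] E} (hA : IsClosed (A.graph : Set (E × E))) :
    IsClosed ((-A).graph : Set (E × E)) := by
  have : ((-A).graph : Set (E × E)) = {p : E × E | (p.1, -p.2) ∈ A.graph} := by
    ext ⟨x, y⟩
    exact mem_graph_neg
  rw [this]
  exact hA.preimage (f := fun p : E × E => (p.1, -p.2)) (by fun_prop)

/-! ### Range conditions for `J`, `-R` and `J - R`. -/

section Complete

variable [CompleteSpace E]

/-- A closed dissipative operator `A` for which `lam - A` has dense range is such that `lam - A`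
is onto. -/
theorem IsDissipative.surjective {A : E →ₗ.[ℂ] E} (hA : IsDissipative A)
    (hc : IsClosed (A.graph : Set (E × E))) {lam : ℝ} (hl : 0 < lam)
    (horth : ∀ w, (∀ x y, (x, y) ∈ A.graph → ⟪(lam : ℂ) • x - y, w⟫_ℂ = 0) → w = 0) (v : E) :
    ∃ x y, (x, y) ∈ A.graph ∧ (lam : ℂ) • x - y = v := by
  let φ : E × E →ₗ[ℂ] E := (lam : ℂ) • LinearMap.fst ℂ E E - LinearMap.snd ℂ E E
  let K : Submodule ℂ E := A.graph.map φ
  have hmem : ∀ w, w ∈ K ↔ ∃ x y, (x, y) ∈ A.graph ∧ (lam : ℂ) • x - y = w := by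
    intro w
    exact ⟨fun ⟨p, h, e⟩ => ⟨p.1, p.2, h, e⟩, fun ⟨x, y, h, e⟩ => ⟨(x, y), h, e⟩⟩
  have hKc : IsClosed (K : Set E) := by
    rw [← isSeqClosed_iff_isClosed]
    intro w w₀ hw hlim
    choose x y hxy hw' using fun n => (hmem _).1 (hw n)
    have hbd : ∀ m n, lam * ‖x m - x n‖ ≤ ‖w m - w n‖ := fun m n => by
      have := norm_smul_le_norm_smul_sub hl.le
        (hA (x m - x n) (y m - y n) (A.graph.sub_mem (hxy m) (hxy n)))
      rwa [smul_sub, sub_sub_sub_comm, hw', hw'] at this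
    have hx : CauchySeq x := by
      rw [Metric.cauchySeq_iff']
      intro ε hε
      obtain ⟨N, hN⟩ := Metric.cauchySeq_iff'.1 hlim.cauchySeq (lam * ε) (by positivity)
      refine ⟨N, fun n hn => ?_⟩
      have h1 := hN n hn
      rw [dist_eq_norm] at h1 ⊢
      exact lt_of_mul_lt_mul_left ((hbd n N).trans_lt h1) hl.le
    obtain ⟨x₀, hx₀⟩ := cauchySeq_tendsto_of_complete hx
    -- Only `x n` is controlled by dissipativity; convergence of `y n` is read off from `y n = lam x
    -- n - w n`.
    have hy : Tendsto y atTop (𝓝 ((lam : ℂ) • x₀ - w₀)) := by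
      have : y = fun n => (lam : ℂ) • x n - w n := by
        funext n; rw [← hw' n]; simp
      rw [this]
      exact (hx₀.const_smul _).sub hlim
    refine (hmem _).2 ⟨x₀, (lam : ℂ) • x₀ - w₀, ?_, by simp⟩
    exact hc.mem_of_tendsto (hx₀.prodMk_nhds hy) (Eventually.of_forall hxy)
  have hperp : Kᗮ = ⊥ := by
    rw [Submodule.eq_bot_iff]
    intro w hw
    refine horth w fun x y h => ?_
    exact (Submodule.mem_orthogonal _ _).1 hw _ ((hmem _).2 ⟨x, y, h, rfl⟩)
  have : CompleteSpace K := hKc.completeSpace_coe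
  have : K = ⊤ := (Submodule.orthogonal_eq_bot_iff).1 hperp
  exact (hmem v).1 (this ▸ Submodule.mem_top)

theorem mem_graph_adjoint {A : E →ₗ.[ℂ] E} (hd : Dense (A.domain : Set E)) {w z : E} :
    (w, z) ∈ A.adjoint.graph ↔ ∀ x y, (x, y) ∈ A.graph → ⟪z, x⟫_ℂ = ⟪w, y⟫_ℂ := by
  constructor
  · intro h x y hxy
    obtain ⟨⟨a, ha⟩, rfl, rfl⟩ := (LinearPMap.mem_graph_iff _).1 h
    obtain ⟨b, rfl, rfl⟩ := (LinearPMap.mem_graph_iff _).1 hxy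
    exact LinearPMap.adjoint_isFormalAdjoint hd ⟨a, ha⟩ b
  · intro h
    have h' : ∀ x : A.domain, ⟪z, (x : E)⟫_ℂ = ⟪w, A x⟫_ℂ := fun x => h _ _ (A.mem_graph x)
    have hw := LinearPMap.mem_adjoint_domain_of_exists w ⟨z, h'⟩
    refine (LinearPMap.mem_graph_iff _).2 ⟨⟨w, hw⟩, rfl, ?_⟩
    exact LinearPMap.adjoint_apply_eq hd _ h'

theorem isClosed_graph_adjoint {A : E →ₗ.[ℂ] E} (hd : Dense (A.domain : Set E)) :
    IsClosed (A.adjoint.graph : Set (E × E)) :=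
  LinearPMap.adjoint_isClosed hd

theorem IsNonnegSelfAdjoint.inner_eq {R : E →ₗ.[ℂ] E} (hR : IsNonnegSelfAdjoint R) {x y x' y' : E}
    (h : (x, y) ∈ R.graph) (h' : (x', y') ∈ R.graph) : ⟪y, x'⟫_ℂ = ⟪x, y'⟫_ℂ := by
  rw [← hR.2.1, mem_graph_adjoint hR.1] at h
  exact h _ _ h'

theorem IsNonnegSelfAdjoint.re_inner_nonneg {R : E →ₗ.[ℂ] E} (hR : IsNonnegSelfAdjoint R)
    {x y : E} (h : (x, y) ∈ R.graph) : 0 ≤ (⟪y, x⟫_ℂ).re := by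
  obtain ⟨b, rfl, rfl⟩ := (LinearPMap.mem_graph_iff _).1 h
  exact hR.2.2 b

theorem IsNonnegSelfAdjoint.isClosed_graph {R : E →ₗ.[ℂ] E} (hR : IsNonnegSelfAdjoint R) :
    IsClosed (R.graph : Set (E × E)) := by
  rw [← hR.2.1]; exact isClosed_graph_adjoint hR.1

theorem IsNonnegSelfAdjoint.isDissipative_neg {R : E →ₗ.[ℂ] E} (hR : IsNonnegSelfAdjoint R) :
    IsDissipative (-R) := by
  intro x y h
  have := hR.re_inner_nonneg (mem_graph_neg.1 h)
  rw [inner_neg_left, Complex.neg_re] at this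
  linarith

/-- A vector `w` orthogonal to the range of `lam + R` lies in `dom R* = dom R` with `R w = -lam w`,
and `R ≥ 0` forces `w = 0`. -/
theorem IsNonnegSelfAdjoint.surjective {R : E →ₗ.[ℂ] E} (hR : IsNonnegSelfAdjoint R) {lam : ℝ}
    (hl : 0 < lam) (v : E) : ∃ x y, (x, y) ∈ (-R).graph ∧ (lam : ℂ) • x - y = v := by
  refine hR.isDissipative_neg.surjective (isClosed_graph_neg hR.isClosed_graph) hl ?_ v
  intro w hw
  have h1 : (w, ((-lam : ℝ) : ℂ) • w) ∈ R.graph := by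
    rw [← hR.2.1, mem_graph_adjoint hR.1]
    intro x y hxy
    have h2 := hw x (-y) (mem_graph_neg.2 (by simpa using hxy))
    rw [← inner_conj_symm, map_eq_zero, sub_neg_eq_add, inner_add_right, inner_smul_right] at h2
    rw [inner_smul_left, Complex.conj_ofReal, Complex.ofReal_neg, neg_mul]
    exact neg_eq_of_add_eq_zero_right h2
  have h2 := hR.re_inner_nonneg h1
  rw [re_inner_real_smul_self] at h2
  have : ‖w‖ ^ 2 ≤ 0 := by
    by_contra hc
    push Not at hc
    nlinarith [mul_pos hl hc]
  simpa using le_antisymm this (sq_nonneg _)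

theorem IsSkewAdjoint.re_inner_eq_zero {J : E →ₗ.[ℂ] E} (hJ : IsSkewAdjoint J) {x y : E}
    (h : (x, y) ∈ J.graph) : (⟪y, x⟫_ℂ).re = 0 := by
  have h1 : (x, -y) ∈ J.adjoint.graph := by
    rw [hJ.2, mem_graph_neg, neg_neg]; exact h
  have h2 := congrArg Complex.re ((mem_graph_adjoint hJ.1).1 h1 _ _ h)
  have h3 : (⟪x, y⟫_ℂ).re = (⟪y, x⟫_ℂ).re := inner_re_symm (𝕜 := ℂ) x y
  rw [inner_neg_left, Complex.neg_re, h3] at h2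
  linarith

theorem IsSkewAdjoint.isDissipative {J : E →ₗ.[ℂ] E} (hJ : IsSkewAdjoint J) : IsDissipative J :=
  fun _ _ h => (hJ.re_inner_eq_zero h).le

theorem IsSkewAdjoint.isClosed_graph {J : E →ₗ.[ℂ] E} (hJ : IsSkewAdjoint J) :
    IsClosed (J.graph : Set (E × E)) := by
  have := isClosed_graph_neg (isClosed_graph_adjoint hJ.1)
  rwa [hJ.2, neg_neg] at this

/-- A vector `w` orthogonal to the range satisfies `J* w = lam w`, hence `J w = -lam w`; as `Re ⟨J
w, w⟩ = 0`, it vanishes. -/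
theorem IsSkewAdjoint.surjective {J : E →ₗ.[ℂ] E} (hJ : IsSkewAdjoint J) {lam : ℝ}
    (hl : 0 < lam) (v : E) : ∃ x y, (x, y) ∈ J.graph ∧ (lam : ℂ) • x - y = v := by
  refine hJ.isDissipative.surjective hJ.isClosed_graph hl ?_ v
  intro w hw
  have h1 : (w, ((lam : ℝ) : ℂ) • w) ∈ J.adjoint.graph := by
    rw [mem_graph_adjoint hJ.1]
    intro x y hxy
    have h2 := hw x y hxy
    rw [← inner_conj_symm, map_eq_zero, inner_sub_right, inner_smul_right] at h2
    rw [inner_smul_left, Complex.conj_ofReal]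
    exact sub_eq_zero.1 h2
  rw [hJ.2, mem_graph_neg] at h1
  have h2 := hJ.re_inner_eq_zero h1
  rw [inner_neg_left, Complex.neg_re, re_inner_real_smul_self] at h2
  have : ‖w‖ ^ 2 = 0 := by
    rcases mul_eq_zero.1 (neg_eq_zero.1 h2) with h | h
    · exact absurd h hl.ne'
    · exact h
  simpa using this

/-- Perturbation of an m-dissipative operator by a relatively bounded one. -/
theorem surjective_of_isRelBoundedLTOne {L M : E →ₗ.[ℂ] E} (hL : IsDissipative L)
    (hs : ∀ lam : ℝ, 0 < lam → ∀ v, ∃ x y, (x, y) ∈ L.graph ∧ (lam : ℂ) • x - y = v)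
    (hM : IsRelBoundedLTOne M L) :
    ∃ lam₀ : ℝ, 0 < lam₀ ∧ ∀ lam : ℝ, lam₀ ≤ lam → ∀ v, ∃ x y z,
      (x, y) ∈ L.graph ∧ (x, z) ∈ M.graph ∧ (lam : ℂ) • x - (y + z) = v := by
  obtain ⟨hdom, a, b, ha0, ha1, hb, hbd⟩ := hM
  -- Chosen so that `a + b / lam < 1`, which bounds the norm of `M (lam - L)⁻¹`.
  refine ⟨(b + 1) / (1 - a), div_pos (by linarith) (by linarith), fun lam hlam v => ?_⟩
  have hl : 0 < lam := lt_of_lt_of_le (div_pos (by linarith) (by linarith)) hlam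
  obtain ⟨G, hG⟩ := exists_isResolvent hL hl (hs lam hl)
  have hGd : ∀ w, G w ∈ L.domain := fun w => LinearPMap.mem_domain_of_mem_graph (hG.mem_graph w)
  let N₀ : E →ₗ[ℂ] E := M.toFun ∘ₗ (G : E →ₗ[ℂ] E).codRestrict M.domain fun w => hdom (hGd w)
  have hN₀ : ∀ w, ‖N₀ w‖ ≤ (a + b / lam) * ‖w‖ := fun w => by
    have h1 := hbd ⟨G w, hGd w⟩
    have h2 : L ⟨G w, hGd w⟩ = (lam : ℂ) • G w - w :=
      L.mem_graph_snd_inj (L.mem_graph ⟨G w, hGd w⟩) (hG.mem_graph w) rfl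
    have h3 := norm_le_norm_smul_sub hl.le (hL _ _ (hG.mem_graph w))
    have h4 := hG.norm_apply_le hL hl.le w
    have h5 : ‖G w‖ ≤ ‖w‖ / lam := by rwa [le_div_iff₀ hl, mul_comm]
    rw [sub_sub_cancel] at h3
    rw [h2] at h1
    calc ‖N₀ w‖ ≤ a * ‖(lam : ℂ) • G w - w‖ + b * ‖G w‖ := h1
      _ ≤ a * ‖w‖ + b * (‖w‖ / lam) := by gcongr
      _ = _ := by ring
  let N : E →L[ℂ] E := N₀.mkContinuous _ hN₀
  have hN : ‖N‖ < 1 := by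
    refine (LinearMap.mkContinuous_norm_le _ (by positivity) hN₀).trans_lt ?_
    have : b < lam * (1 - a) := by
      rw [div_le_iff₀ (by linarith)] at hlam
      linarith
    have : b / lam < 1 - a := by rwa [div_lt_iff₀ hl, mul_comm]
    linarith
  -- Since `lam - (L + M) = (1 - M G) (lam - L)` with `G = (lam - L)⁻¹`, inverting `1 - M G` by a
  -- Neumann series solves the equation.
  have hu := isUnit_one_sub_of_norm_lt_one hN
  obtain ⟨u, hu⟩ := hu
  let w := (↑u⁻¹ : E →L[ℂ] E) v
  have hw : w - N w = v := by
    have h1 : (1 - N) * (↑u⁻¹ : E →L[ℂ] E) = 1 := by rw [← hu]; exact u.mul_inv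
    have := congrArg (fun T : E →L[ℂ] E => T v) h1
    simpa using this
  refine ⟨G w, (lam : ℂ) • G w - w, N w, hG.mem_graph w, M.mem_graph ⟨G w, hdom (hGd w)⟩, ?_⟩
  rw [← hw]
  abel

theorem isDissipative_sub {J R : E →ₗ.[ℂ] E} (hJ : IsSkewAdjoint J) (hR : IsNonnegSelfAdjoint R) :
    IsDissipative (J - R) := by
  intro x y h
  obtain ⟨z, w, hz, hw, rfl⟩ := mem_graph_sub.1 h
  rw [inner_sub_left, Complex.sub_re, hJ.re_inner_eq_zero hz]
  linarith [hR.re_inner_nonneg hw]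

theorem dense_domain_sub {J R : E →ₗ.[ℂ] E} (hJ : IsSkewAdjoint J) (hR : IsNonnegSelfAdjoint R)
    (hJR : IsRelBoundedLTOne J R ∨ IsRelBoundedLTOne R J) : Dense ((J - R).domain : Set E) := by
  rw [LinearPMap.sub_domain]
  rcases hJR with ⟨h, -⟩ | ⟨h, -⟩
  · rw [inf_eq_right.2 h]; exact hR.1
  · rw [inf_eq_left.2 h]; exact hJ.1

/-- Whichever of `J` and `-R` dominates is taken as the unperturbed m-dissipative operator, and the
other as the perturbation. -/
theorem exists_isResolvent_sub {J R : E →ₗ.[ℂ] E} (hJ : IsSkewAdjoint J)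
    (hR : IsNonnegSelfAdjoint R) (hJR : IsRelBoundedLTOne J R ∨ IsRelBoundedLTOne R J) :
    ∃ lam₀ : ℝ, 0 < lam₀ ∧ ∀ lam : ℝ, lam₀ ≤ lam → ∃ G, IsResolvent (J - R) lam G := by
  rcases hJR with ⟨hd, a, b, ha0, ha1, hb, hbd⟩ | ⟨hd, a, b, ha0, ha1, hb, hbd⟩
  · have hrel : IsRelBoundedLTOne J (-R) :=
      ⟨hd, a, b, ha0, ha1, hb, fun x => by rw [LinearPMap.neg_apply, norm_neg]; exact hbd x⟩
    obtain ⟨l₀, hl₀, h⟩ := surjective_of_isRelBoundedLTOne hR.isDissipative_neg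
      (fun _ hl => hR.surjective hl) hrel
    refine ⟨l₀, hl₀, fun l hl => exists_isResolvent (isDissipative_sub hJ hR) (hl₀.trans_le hl) ?_⟩
    intro v
    obtain ⟨x, y, z, hy, hz, hv⟩ := h l hl v
    exact ⟨x, y + z, mem_graph_sub.2 ⟨z, -y, hz, mem_graph_neg.1 hy, by abel⟩, hv⟩
  · have hrel : IsRelBoundedLTOne (-R) J :=
      ⟨hd, a, b, ha0, ha1, hb, fun x => by rw [LinearPMap.neg_apply, norm_neg]; exact hbd x⟩
    obtain ⟨l₀, hl₀, h⟩ := surjective_of_isRelBoundedLTOne hJ.isDissipative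
      (fun _ hl => hJ.surjective hl) hrel
    refine ⟨l₀, hl₀, fun l hl => exists_isResolvent (isDissipative_sub hJ hR) (hl₀.trans_le hl) ?_⟩
    intro v
    obtain ⟨x, y, z, hy, hz, hv⟩ := h l hl v
    exact ⟨x, y + z, mem_graph_sub.2 ⟨y, -z, hy, mem_graph_neg.1 hz, by abel⟩, hv⟩

end Complete

/-! ### The square root of a non-negative self-adjoint operator. -/

section SquareRoot

/-- If `P, Q ≥ 0` commute and `P² + Q² = 1`, then `P z = Q y` exactly when `(y, z) = (P w, Q w)`
for some `w`. -/
theorem exists_eq_apply_of_apply_eq {P Q : E →L[ℂ] E} (hPQ : Commute P Q)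
    (h1 : P * P + Q * Q = 1) {y z : E} (h : P z = Q y) :
    y = P (P y + Q z) ∧ z = Q (P y + Q z) := by
  have hone : ∀ v, P (P v) + Q (Q v) = v := fun v => by
    simpa using congrArg (fun T : E →L[ℂ] E => T v) h1
  have hcomm : ∀ v, P (Q v) = Q (P v) := fun v => by
    simpa using congrArg (fun T : E →L[ℂ] E => T v) hPQ.eq
  constructor
  · rw [map_add, hcomm, h, hone]
  · rw [map_add, ← hcomm, ← h, hone]

variable [CompleteSpace E]

/-- Formally `R = Q² P⁻²`, so the candidate is `S = Q P⁻¹`, whose graph is the range of `w ↦ (P w, Q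
w)`. This parametrisation replaces domain considerations by algebra of bounded operators. -/
theorem exists_isPosSqrt_of_commute {R : E →ₗ.[ℂ] E} (hd : Dense (R.domain : Set E))
    {P Q : E →L[ℂ] E} (hP : 0 ≤ P) (hQ : 0 ≤ Q) (hPQ : Commute P Q) (h1 : P * P + Q * Q = 1)
    (hinj : ∀ v, P v = 0 → v = 0)
    (hR : ∀ x y, (x, y) ∈ R.graph ↔ ∃ w, x = P (P w) ∧ y = Q (Q w)) : ∃ S, IsPosSqrt R S := by
  have hcomm : ∀ v, P (Q v) = Q (P v) := fun v => by
    simpa using congrArg (fun T : E →L[ℂ] E => T v) hPQ.eq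
  have hPs : ∀ v w, ⟪P v, w⟫_ℂ = ⟪v, P w⟫_ℂ :=
    ((ContinuousLinearMap.nonneg_iff_isPositive P).1 hP).isSymmetric
  have hQs : ∀ v w, ⟪Q v, w⟫_ℂ = ⟪v, Q w⟫_ℂ :=
    ((ContinuousLinearMap.nonneg_iff_isPositive Q).1 hQ).isSymmetric
  let g : Submodule ℂ (E × E) := LinearMap.range (P.prod Q : E →ₗ[ℂ] E × E)
  have hg : ∀ x ∈ g, x.1 = 0 → x.2 = 0 := by
    rintro _ ⟨w, rfl⟩ h
    have : w = 0 := hinj w h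
    simp [this]
  let S : E →ₗ.[ℂ] E := g.toLinearPMap
  have hS : ∀ x y, (x, y) ∈ S.graph ↔ ∃ w, x = P w ∧ y = Q w := by
    intro x y
    have : S.graph = g := Submodule.toLinearPMap_graph_eq g hg
    rw [this]
    constructor
    · rintro ⟨w, hw⟩
      exact ⟨w, (congrArg Prod.fst hw).symm, (congrArg Prod.snd hw).symm⟩
    · rintro ⟨w, rfl, rfl⟩
      exact ⟨w, rfl⟩
  have hSd : Dense (S.domain : Set E) := by
    refine hd.mono fun x hx => ?_
    obtain ⟨w, hw, -⟩ := (hR _ _).1 (R.mem_graph ⟨x, hx⟩)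
    exact LinearPMap.mem_domain_of_mem_graph ((hS x (Q (P w))).2 ⟨P w, hw, rfl⟩)
  refine ⟨S, ⟨hSd, ?_, ?_⟩, ?_⟩
  · refine LinearPMap.eq_of_eq_graph ?_
    ext ⟨y, z⟩
    rw [mem_graph_adjoint hSd, hS]
    constructor
    · intro h
      -- Testing the adjoint relation on all `(P v, Q v)` gives `P z = Q y`, which places `(y, z)`
      -- back in the range of `w ↦ (P w, Q w)`.
      have hyz : P z = Q y := by
        refine ext_inner_right ℂ fun v => ?_
        rw [hPs, hQs]
        exact h _ _ ((hS _ _).2 ⟨v, rfl, rfl⟩)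
      exact ⟨_, exists_eq_apply_of_apply_eq hPQ h1 hyz⟩
    · rintro ⟨w, rfl, rfl⟩ x' y' h'
      obtain ⟨v, rfl, rfl⟩ := (hS _ _).1 h'
      rw [hPs w, hQs w, hcomm]
  · intro x
    obtain ⟨w, hw, hw'⟩ := (hS _ _).1 (S.mem_graph x)
    rw [hw, hw', ← hPs]
    exact ((ContinuousLinearMap.nonneg_iff_isPositive _).1
      (hPQ.mul_nonneg hP hQ)).re_inner_nonneg_left w
  · intro x y
    rw [hR]
    constructor
    · rintro ⟨w, rfl, rfl⟩
      exact ⟨Q (P w), (hS _ _).2 ⟨P w, rfl, rfl⟩, (hS _ _).2 ⟨Q w, (hcomm w).symm, rfl⟩⟩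
    · rintro ⟨z, hz, hz'⟩
      obtain ⟨a, rfl, rfl⟩ := (hS _ _).1 hz
      obtain ⟨b, hb, rfl⟩ := (hS _ _).1 hz'
      obtain ⟨h2, h3⟩ := exists_eq_apply_of_apply_eq hPQ h1 hb.symm
      exact ⟨P a + Q b, congrArg P h2, congrArg Q h3⟩

/-- With `K = (1 + R)⁻¹` the graph of `R` is `{(K w, w - K w)}` and `0 ≤ K ≤ 1`, so `P = √K` and `Q
= √(1 - K)` satisfy the previous construction. -/
theorem IsNonnegSelfAdjoint.exists_isPosSqrt {R : E →ₗ.[ℂ] E} (hR : IsNonnegSelfAdjoint R) :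
    ∃ S, IsPosSqrt R S := by
  obtain ⟨K, hK⟩ := exists_isResolvent hR.isDissipative_neg one_pos (hR.surjective one_pos)
  have hKR : ∀ x y, (x, y) ∈ R.graph ↔ K (x + y) = x := fun x y => by
    have := hK x (-y)
    rw [mem_graph_neg, neg_neg, Complex.ofReal_one, one_smul, sub_neg_eq_add] at this
    exact this
  have hKg : ∀ v, (K v, v - K v) ∈ R.graph := fun v => by rw [hKR]; simp
  have hsymm : ∀ v w, ⟪K v, w⟫_ℂ = ⟪v, K w⟫_ℂ := fun v w => by
    have h := hR.inner_eq (hKg v) (hKg w)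
    rw [inner_sub_left, inner_sub_right, sub_left_inj] at h
    exact h.symm
  have hpos : 0 ≤ K := by
    rw [ContinuousLinearMap.nonneg_iff_isPositive]
    refine ⟨hsymm, fun v => ?_⟩
    have h := hR.re_inner_nonneg (hKg v)
    rw [inner_sub_left, Complex.sub_re] at h
    have h2 : (⟪K v, K v⟫_ℂ).re = ‖K v‖ ^ 2 := by
      simpa using re_inner_real_smul_self 1 (K v)
    have h3 : (⟪K v, v⟫_ℂ).re = (⟪v, K v⟫_ℂ).re := by rw [hsymm]
    change 0 ≤ (⟪K v, v⟫_ℂ).re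
    rw [h3]
    nlinarith [sq_nonneg ‖K v‖]
  have hpos' : 0 ≤ 1 - K := by
    rw [ContinuousLinearMap.nonneg_iff_isPositive]
    refine ⟨fun v w => ?_, fun v => ?_⟩
    · have := hsymm v w
      simp [inner_sub_left, inner_sub_right, this]
    · have h := hR.re_inner_nonneg (hKg v)
      have h2 : (⟪v - K v, v - K v⟫_ℂ).re = ‖v - K v‖ ^ 2 := by
        simpa using re_inner_real_smul_self 1 (v - K v)
      have h3 : ⟪v - K v, v⟫_ℂ = ⟪v - K v, v - K v⟫_ℂ + ⟪v - K v, K v⟫_ℂ := by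
        rw [← inner_add_right, sub_add_cancel]
      change 0 ≤ (⟪v - K v, v⟫_ℂ).re
      rw [h3, Complex.add_re, h2]
      positivity
  have hPP := CFC.sqrt_mul_sqrt_self K hpos
  have hQQ := CFC.sqrt_mul_sqrt_self (1 - K) hpos'
  have hcomm : Commute (CFC.sqrt K) (CFC.sqrt (1 - K)) := by
    have h0 : Commute K (1 - K) := (Commute.one_right K).sub_right (Commute.refl K)
    exact ((h0.cfcₙ_nnreal _).symm.cfcₙ_nnreal _).symm
  have hPP' : ∀ v, CFC.sqrt K (CFC.sqrt K v) = K v := fun v => by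
    simpa using congrArg (fun T : E →L[ℂ] E => T v) hPP
  have hQQ' : ∀ v, CFC.sqrt (1 - K) (CFC.sqrt (1 - K) v) = v - K v := fun v => by
    simpa using congrArg (fun T : E →L[ℂ] E => T v) hQQ
  refine exists_isPosSqrt_of_commute hR.1 (CFC.sqrt_nonneg K) (CFC.sqrt_nonneg (1 - K)) hcomm
    (by rw [hPP, hQQ]; abel) (fun v hv => ?_) fun x y => ?_
  · have h0 : K v = 0 := by rw [← hPP', hv, map_zero]
    have h1 := hKg v
    rw [h0, sub_zero] at h1
    exact R.graph_fst_eq_zero_snd h1 rfl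
  · simp only [hPP', hQQ']
    constructor
    · intro h
      have h' := (hKR x y).1 h
      exact ⟨x + y, h'.symm, by rw [h']; abel⟩
    · rintro ⟨w, rfl, rfl⟩
      exact hKg w

theorem isPosSqrt_posSqrt {R : E →ₗ.[ℂ] E} (hR : IsNonnegSelfAdjoint R) :
    IsPosSqrt R (posSqrt R) :=
  Classical.epsilon_spec hR.exists_isPosSqrt

end SquareRoot

/-! ### Strong convergence of resolvents and the Yosida approximation. -/

theorem hasDerivWithinAt_norm_sq {y : ℝ → E} {y' : E} {s : Set ℝ} {t : ℝ}
    (h : HasDerivWithinAt y y' s t) :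
    HasDerivWithinAt (fun t => ‖y t‖ ^ 2) (2 * (⟪y', y t⟫_ℂ).re) s t := by
  let := InnerProductSpace.complexToReal (G := E)
  have h1 := h.norm_sq
  have h2 : ⟪y t, y'⟫_ℝ = (⟪y', y t⟫_ℂ).re := by
    rw [real_inner_comm]; rfl
  rwa [h2] at h1

/-- Strong convergence of contractions to the identity on a dense set extends to the whole
space. -/
theorem tendsto_apply_of_dense {ι : Type*} {l : Filter ι} {F : ι → E →L[ℂ] E}
    (hF : ∀ᶠ i in l, ∀ v, ‖F i v‖ ≤ ‖v‖) {D : Set E} (hD : Dense D)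
    (h : ∀ x ∈ D, Tendsto (fun i => F i x) l (𝓝 x)) (v : E) :
    Tendsto (fun i => F i v) l (𝓝 v) := by
  rw [Metric.tendsto_nhds]
  intro ε hε
  obtain ⟨x, hx, hvx⟩ := hD.exists_dist_lt v (show 0 < ε / 3 by positivity)
  filter_upwards [hF, Metric.tendsto_nhds.1 (h x hx) (ε / 3) (by positivity)] with i h1 h2
  have h3 : dist (F i v) (F i x) ≤ dist v x := by
    rw [dist_eq_norm, dist_eq_norm, ← map_sub]; exact h1 _
  have h4 := dist_triangle4 (F i v) (F i x) x v
  rw [dist_comm x v] at h4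
  linarith

/-- On `dom A`, `lam G x - x = G (A x)` has norm at most `‖A x‖ / lam`; density and the bound `‖lam
G‖ ≤ 1` do the rest. -/
theorem tendsto_resolvent {A : E →ₗ.[ℂ] E} (hA : IsDissipative A)
    (hd : Dense (A.domain : Set E)) {lam : ℕ → ℝ} (hpos : ∀ k, 0 < lam k)
    (hlam : Tendsto lam atTop atTop) {G : ℕ → E →L[ℂ] E} (hG : ∀ k, IsResolvent A (lam k) (G k))
    (v : E) : Tendsto (fun k => (lam k : ℂ) • G k v) atTop (𝓝 v) := by
  have hb : ∀ k v, ‖((lam k : ℂ) • G k) v‖ ≤ ‖v‖ := fun k v => by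
    rw [_root_.smul_apply, norm_smul, Complex.norm_real,
      Real.norm_of_nonneg (hpos k).le]
    exact (hG k).norm_apply_le hA (hpos k).le v
  refine tendsto_apply_of_dense (F := fun k => (lam k : ℂ) • G k) (Eventually.of_forall hb) hd ?_ v
  intro x hx
  have hxy := A.mem_graph ⟨x, hx⟩
  set y := A ⟨x, hx⟩
  have h1 : ∀ k, (lam k : ℂ) • G k x - x = G k y := fun k => by
    have := (hG k x y).1 hxy
    rw [map_sub, map_smul, sub_eq_iff_eq_add] at this
    rw [this]; abel
  rw [tendsto_iff_norm_sub_tendsto_zero]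
  have h2 : Tendsto (fun k => ‖y‖ / lam k) atTop (𝓝 0) := tendsto_const_nhds.div_atTop hlam
  refine squeeze_zero (fun _ => norm_nonneg _) (fun k => ?_) h2
  rw [_root_.smul_apply, h1, le_div_iff₀ (hpos k), mul_comm]
  exact (hG k).norm_apply_le hA (hpos k).le y

theorem IsResolvent.commute {A : E →ₗ.[ℂ] E} {l l' : ℝ} {G G' : E →L[ℂ] E}
    (hG : IsResolvent A l G) (hG' : IsResolvent A l' G') : Commute G G' := by
  have key : ∀ {l l' : ℝ} {G G' : E →L[ℂ] E}, IsResolvent A l G → IsResolvent A l' G' →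
      ∀ v, ((l' : ℂ) - l) • G (G' v) = G v - G' v := by
    intro l l' G G' hG hG' v
    have h1 := (hG _ _).1 (hG'.mem_graph v)
    have h2 : (l : ℂ) • G' v - ((l' : ℂ) • G' v - v) = v - ((l' : ℂ) - l) • G' v := by
      rw [sub_smul]; abel
    rw [h2, map_sub, map_smul] at h1
    rw [sub_eq_iff_eq_add] at h1
    rw [h1]; abel
  refine ContinuousLinearMap.ext fun v => ?_
  -- At equal parameters the resolvent identity says nothing about products, but its right side `G v
  -- - G' v` must then vanish.
  by_cases hll : l = l'
  · subst hll
    have : G = G' := ContinuousLinearMap.ext fun v => by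
      have := key hG hG' v
      rw [sub_self, zero_smul] at this
      exact sub_eq_zero.1 this.symm
    rw [this]
  · have hne : (l' : ℂ) - l ≠ 0 := by
      rw [sub_ne_zero]; exact_mod_cast Ne.symm hll
    have h1 := key hG hG' v
    have h2 := key hG' hG v
    have h3 : ((l' : ℂ) - l) • G (G' v) = ((l' : ℂ) - l) • G' (G v) := by
      rw [h1, ← neg_sub (l : ℂ) l', neg_smul, h2]; abel
    exact smul_right_injective E hne h3

/-- The Yosida approximation `lam (lam (lam - A)⁻¹ - 1)`, in terms of the resolvent. -/
def yosida (lam : ℝ) (G : E →L[ℂ] E) : E →L[ℂ] E := (lam : ℂ) • ((lam : ℂ) • G - 1)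

theorem yosida_apply (lam : ℝ) (G : E →L[ℂ] E) (v : E) :
    yosida lam G v = (lam : ℂ) • ((lam : ℂ) • G v - v) := rfl

/-- With `y = A G v` one has `v = lam G v - y`, so `Re ⟨y, v⟩ = lam Re ⟨y, G v⟩ - ‖y‖² ≤ 0`. -/
theorem re_inner_yosida_le {A : E →ₗ.[ℂ] E} (hA : IsDissipative A) {lam : ℝ} (hl : 0 ≤ lam)
    {G : E →L[ℂ] E} (hG : IsResolvent A lam G) (v : E) : (⟪yosida lam G v, v⟫_ℂ).re ≤ 0 := by
  have h1 := hA _ _ (hG.mem_graph v)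
  rw [yosida_apply]
  set y := (lam : ℂ) • G v - v with hy
  have hv : v = (lam : ℂ) • G v - y := by rw [hy]; abel
  have h2 : (⟪y, v⟫_ℂ).re = lam * (⟪y, G v⟫_ℂ).re - ‖y‖ ^ 2 := by
    conv_lhs => rw [hv]
    rw [inner_sub_right, inner_smul_right, Complex.sub_re, Complex.re_ofReal_mul]
    congr 1
    simpa using re_inner_real_smul_self 1 y
  rw [inner_smul_left, Complex.conj_ofReal, Complex.re_ofReal_mul, h2]
  nlinarith [mul_nonneg hl (neg_nonneg.2 h1), sq_nonneg ‖y‖,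
    mul_nonneg hl (mul_nonneg hl (neg_nonneg.2 h1)), mul_nonneg hl (sq_nonneg ‖y‖)]

theorem yosida_commute {l l' : ℝ} {G G' : E →L[ℂ] E} (h : Commute G G') :
    Commute (yosida l G) (yosida l' G') := by
  have h1 : Commute ((l : ℂ) • G - 1) ((l' : ℂ) • G' - 1) :=
    (((h.smul_left _).smul_right _).sub_right (Commute.one_right _)).sub_left
      (Commute.one_left _)
  exact (h1.smul_left _).smul_right _

theorem yosida_apply_of_mem_graph {A : E →ₗ.[ℂ] E} {lam : ℝ}
    {G : E →L[ℂ] E} (hG : IsResolvent A lam G) {x y : E} (h : (x, y) ∈ A.graph) :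
    yosida lam G x = (lam : ℂ) • G y := by
  have := (hG x y).1 h
  rw [map_sub, map_smul, sub_eq_iff_eq_add] at this
  rw [yosida_apply, this]
  congr 1
  abel

/-! ### Exponentials of bounded dissipative operators and the Hille–Yosida theorem. -/

section HilleYosida

variable [CompleteSpace E]

theorem hasDerivAt_exp_apply (A : E →L[ℂ] E) (x : E) (t : ℝ) :
    HasDerivAt (fun t : ℝ => NormedSpace.exp (t • A) x) (NormedSpace.exp (t • A) (A x)) t :=
  ((ContinuousLinearMap.apply ℂ E x).restrictScalars ℝ).hasFDerivAt.comp_hasDerivAt t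
    (hasDerivAt_exp_smul_const (𝕂 := ℝ) A t)

theorem hasDerivAt_exp_apply' (A : E →L[ℂ] E) (x : E) (t : ℝ) :
    HasDerivAt (fun t : ℝ => NormedSpace.exp (t • A) x) (A (NormedSpace.exp (t • A) x)) t :=
  ((ContinuousLinearMap.apply ℂ E x).restrictScalars ℝ).hasFDerivAt.comp_hasDerivAt t
    (hasDerivAt_exp_smul_const' (𝕂 := ℝ) A t)

theorem norm_exp_apply_le {A : E →L[ℂ] E} (hA : ∀ x, (⟪A x, x⟫_ℂ).re ≤ 0) {t : ℝ} (ht : 0 ≤ t)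
    (x : E) : ‖NormedSpace.exp (t • A) x‖ ≤ ‖x‖ := by
  have hder : ∀ t : ℝ, HasDerivAt (fun t : ℝ => ‖NormedSpace.exp (t • A) x‖ ^ 2)
      (2 * (⟪A (NormedSpace.exp (t • A) x), NormedSpace.exp (t • A) x⟫_ℂ).re) t := fun t =>
    hasDerivWithinAt_univ.1
      (hasDerivWithinAt_norm_sq (hasDerivAt_exp_apply' A x t).hasDerivWithinAt)
  have hanti := antitone_of_deriv_nonpos (fun t => (hder t).differentiableAt) fun t => by
    rw [(hder t).deriv]
    linarith [hA (NormedSpace.exp (t • A) x)]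
  have := hanti ht
  simp only [zero_smul, NormedSpace.exp_zero, one_apply_eq_self] at this
  exact le_of_sq_le_sq this (norm_nonneg _)

/-- The path `s ↦ exp (t B) exp (s (A - B)) x` joins the two vectors. By commutativity it equals
`exp (s A) exp ((t - s) B) x`, so its derivative is a contraction applied to `(A - B) x`. -/
theorem norm_exp_apply_sub_exp_apply_le {A B : E →L[ℂ] E} (hAB : Commute A B)
    (hA : ∀ x, (⟪A x, x⟫_ℂ).re ≤ 0) (hB : ∀ x, (⟪B x, x⟫_ℂ).re ≤ 0) {t : ℝ} (ht : 0 ≤ t) (x : E) :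
    ‖NormedSpace.exp (t • A) x - NormedSpace.exp (t • B) x‖ ≤ t * ‖A x - B x‖ := by
  have hexp : ∀ s : ℝ, NormedSpace.exp (t • B) * NormedSpace.exp (s • (A - B)) =
      NormedSpace.exp (s • A) * NormedSpace.exp ((t - s) • B) := fun s => by
    have hBAB : Commute (t • B) (s • (A - B)) :=
      ((hAB.symm.sub_right (Commute.refl B)).smul_left t).smul_right s
    have hAB' : Commute (s • A) ((t - s) • B) := (hAB.smul_left s).smul_right _
    let := NormedAlgebra.restrictScalars ℚ ℂ (E →L[ℂ] E)
    rw [← NormedSpace.exp_add_of_commute hBAB, ← NormedSpace.exp_add_of_commute hAB']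
    congr 1
    rw [smul_sub, sub_smul]; abel
  have hder : ∀ s : ℝ, HasDerivAt
      (fun s : ℝ => NormedSpace.exp (t • B) (NormedSpace.exp (s • (A - B)) x))
      (NormedSpace.exp (t • B) (NormedSpace.exp (s • (A - B)) ((A - B) x))) s := fun s =>
    ((NormedSpace.exp (t • B)).restrictScalars ℝ).hasFDerivAt.comp_hasDerivAt s
      (hasDerivAt_exp_apply (A - B) x s)
  have happ : ∀ (s : ℝ) (v : E), NormedSpace.exp (t • B) (NormedSpace.exp (s • (A - B)) v) =
      NormedSpace.exp (s • A) (NormedSpace.exp ((t - s) • B) v) := fun s v =>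
    congrArg (fun T : E →L[ℂ] E => T v) (hexp s)
  have := norm_image_sub_le_of_norm_deriv_le_segment' (a := 0) (b := t) (C := ‖A x - B x‖)
    (fun s _ => (hder s).hasDerivWithinAt) (fun s hs => by
      rw [happ]
      exact (norm_exp_apply_le hA hs.1 _).trans
        (norm_exp_apply_le hB (by linarith [hs.2]) _)) t ⟨ht, le_rfl⟩
  rw [happ, happ] at this
  simpa [mul_comm] using this

theorem norm_exp_apply_sub_le {A : E →L[ℂ] E} (hA : ∀ x, (⟪A x, x⟫_ℂ).re ≤ 0) {t : ℝ}
    (ht : 0 ≤ t) (x : E) : ‖NormedSpace.exp (t • A) x - x‖ ≤ t * ‖A x‖ := by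
  have := norm_exp_apply_sub_exp_apply_le (Commute.zero_right A) hA (by simp) ht x
  simpa using this

/-- A second-order remainder would involve `A (A x)`, which is uncontrolled along Yosida
approximations when `x` is only in the domain. The free vector `y`, later taken in `dom A` near the
limit of `A x`, makes the estimate survive the limit. -/
theorem norm_exp_apply_sub_sub_le {A : E →L[ℂ] E} (hA : ∀ x, (⟪A x, x⟫_ℂ).re ≤ 0) {t : ℝ}
    (ht : 0 ≤ t) (x y : E) :
    ‖NormedSpace.exp (t • A) x - x - t • A x‖ ≤ t * (2 * ‖A x - y‖ + t * ‖A y‖) := by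
  have hder : ∀ s : ℝ, HasDerivAt (fun s : ℝ => NormedSpace.exp (s • A) x - s • A x)
      (NormedSpace.exp (s • A) (A x) - A x) s := fun s => by
    have := (hasDerivAt_exp_apply A x s).fun_sub ((hasDerivAt_id s).smul_const (A x))
    simpa using this
  have := norm_image_sub_le_of_norm_deriv_le_segment' (a := 0) (b := t)
    (C := 2 * ‖A x - y‖ + t * ‖A y‖)
    (fun s _ => (hder s).hasDerivWithinAt) (fun s hs => by
      have h1 : NormedSpace.exp (s • A) (A x) - A x =
          NormedSpace.exp (s • A) (A x - y) + (NormedSpace.exp (s • A) y - y) - (A x - y) := by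
        rw [map_sub]; abel
      have h2 := norm_exp_apply_le hA hs.1 (A x - y)
      have h3 := norm_exp_apply_sub_le hA hs.1 y
      have h4 : s * ‖A y‖ ≤ t * ‖A y‖ := by gcongr; exact hs.2.le
      rw [h1]
      refine (norm_sub_le _ _).trans ?_
      linarith [norm_add_le (NormedSpace.exp (s • A) (A x - y)) (NormedSpace.exp (s • A) y - y)])
    t ⟨ht, le_rfl⟩
  have h0 : NormedSpace.exp (t • A) x - x - t • A x =
      NormedSpace.exp (t • A) x - t • A x - (NormedSpace.exp ((0 : ℝ) • A) x - (0 : ℝ) • A x) := by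
    simp; abel
  rw [h0]
  simpa [mul_comm] using this

/-- The Hille–Yosida theorem for contraction semigroups on a Hilbert space. -/
theorem exists_isC0Semigroup {A : E →ₗ.[ℂ] E} (hA : IsDissipative A)
    (hd : Dense (A.domain : Set E)) {lam : ℕ → ℝ} (hpos : ∀ k, 0 < lam k)
    (hlam : Tendsto lam atTop atTop) {G : ℕ → E →L[ℂ] E}
    (hG : ∀ k, IsResolvent A (lam k) (G k)) :
    ∃ 𝒯 : ℝ → E →L[ℂ] E, IsC0Semigroup 𝒯 ∧ IsGenerator A 𝒯 := by
  set Y : ℕ → E →L[ℂ] E := fun k => yosida (lam k) (G k) with hY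
  have hdis : ∀ k x, (⟪Y k x, x⟫_ℂ).re ≤ 0 := fun k => re_inner_yosida_le hA (hpos k).le (hG k)
  have hYlim : ∀ x y, (x, y) ∈ A.graph → Tendsto (fun k => Y k x) atTop (𝓝 y) := by
    intro x y h
    simp only [hY, yosida_apply_of_mem_graph (hG _) h]
    exact tendsto_resolvent hA hd hpos hlam hG y
  have hcauchy : ∀ t : ℝ, 0 ≤ t → ∀ v, CauchySeq fun k => NormedSpace.exp (t • Y k) v := by
    intro t ht v
    rw [Metric.cauchySeq_iff']
    intro ε hε
    obtain ⟨x, hx, hvx⟩ := hd.exists_dist_lt v (show 0 < ε / 3 by positivity)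
    have hc := (hYlim x _ (A.mem_graph ⟨x, hx⟩)).cauchySeq
    obtain ⟨N, hN⟩ := Metric.cauchySeq_iff'.1 hc (ε / 3 / (t + 1)) (by positivity)
    refine ⟨N, fun n hn => ?_⟩
    have h1 : ∀ k, dist (NormedSpace.exp (t • Y k) v) (NormedSpace.exp (t • Y k) x) < ε / 3 := by
      intro k
      refine lt_of_le_of_lt ?_ hvx
      rw [dist_eq_norm, dist_eq_norm, ← map_sub]
      exact norm_exp_apply_le (hdis k) ht _
    have h2 : dist (NormedSpace.exp (t • Y n) x) (NormedSpace.exp (t • Y N) x) < ε / 3 := by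
      rw [dist_eq_norm]
      refine (norm_exp_apply_sub_exp_apply_le (yosida_commute ((hG n).commute (hG N)))
        (hdis n) (hdis N) ht x).trans_lt ?_
      have h3 := hN n hn
      rw [dist_eq_norm, lt_div_iff₀ (by positivity)] at h3
      nlinarith [norm_nonneg (Y n x - Y N x)]
    have h4 := dist_triangle4 (NormedSpace.exp (t • Y n) v) (NormedSpace.exp (t • Y n) x)
      (NormedSpace.exp (t • Y N) x) (NormedSpace.exp (t • Y N) v)
    have h5 := h1 N
    rw [dist_comm] at h5
    linarith [h1 n]
  choose f hf using fun (t : ℝ) (v : E) =>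
    cauchySeq_tendsto_of_complete (hcauchy (max t 0) (le_max_right _ _) v)
  -- The exponentials are contractions only for `t ≥ 0`; truncating at `0` makes the limit exist for
  -- every real `t`.
  let 𝒯 : ℝ → E →L[ℂ] E := fun t =>
    continuousLinearMapOfTendsto (fun k => NormedSpace.exp (max t 0 • Y k)) (f := f t)
      (tendsto_pi_nhds.2 (hf t))
  have h𝒯 : ∀ t, 0 ≤ t → ∀ v, Tendsto (fun k => NormedSpace.exp (t • Y k) v) atTop (𝓝 (𝒯 t v)) := by
    intro t ht v
    have := hf t v
    rw [max_eq_left ht] at this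
    exact this
  have hcontr : ∀ t, 0 ≤ t → ∀ v, ‖𝒯 t v‖ ≤ ‖v‖ := fun t ht v =>
    le_of_tendsto (h𝒯 t ht v).norm (Eventually.of_forall fun k => norm_exp_apply_le (hdis k) ht v)
  have hdom : ∀ x y, (x, y) ∈ A.graph → ∀ t, 0 ≤ t → ‖𝒯 t x - x‖ ≤ t * ‖y‖ := fun x y h t ht =>
    le_of_tendsto_of_tendsto ((h𝒯 t ht x).sub_const x).norm ((hYlim x y h).norm.const_mul t)
      (Eventually.of_forall fun k => norm_exp_apply_sub_le (hdis k) ht x)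
  have hzero : 𝒯 0 = ContinuousLinearMap.id ℂ E := by
    ext v
    refine tendsto_nhds_unique (h𝒯 0 le_rfl v) ?_
    simp
  have hlim0 : ∀ v, Tendsto (fun t => 𝒯 t v) (𝓝[>] 0) (𝓝 v) := by
    refine tendsto_apply_of_dense ?_ hd ?_
    · filter_upwards [self_mem_nhdsWithin] with t ht
      exact hcontr t (le_of_lt ht)
    · intro x hx
      rw [tendsto_iff_norm_sub_tendsto_zero]
      have h1 : Tendsto (fun t : ℝ => t * ‖A ⟨x, hx⟩‖) (𝓝[>] 0) (𝓝 0) := by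
        have : Tendsto (fun t : ℝ => t * ‖A ⟨x, hx⟩‖) (𝓝 0) (𝓝 (0 * ‖A ⟨x, hx⟩‖)) :=
          tendsto_id.mul_const _
        rw [zero_mul] at this
        exact this.mono_left nhdsWithin_le_nhds
      refine squeeze_zero' (Eventually.of_forall fun _ => norm_nonneg _) ?_ h1
      filter_upwards [self_mem_nhdsWithin] with t ht
      exact hdom x _ (A.mem_graph ⟨x, hx⟩) t (le_of_lt ht)
  have hadd : ∀ s t : ℝ, 0 ≤ s → 0 ≤ t → 𝒯 (s + t) = (𝒯 s).comp (𝒯 t) := by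
    intro s t hs ht
    ext v
    refine tendsto_nhds_unique (h𝒯 _ (add_nonneg hs ht) v) ?_
    have h1 : ∀ k, NormedSpace.exp ((s + t) • Y k) v =
        NormedSpace.exp (s • Y k) (NormedSpace.exp (t • Y k) v - 𝒯 t v) +
          NormedSpace.exp (s • Y k) (𝒯 t v) := fun k => by
      rw [map_sub, sub_add_cancel, add_smul]
      let := NormedAlgebra.restrictScalars ℚ ℂ (E →L[ℂ] E)
      rw [NormedSpace.exp_add_of_commute (((Commute.refl (Y k)).smul_left s).smul_right t)]
      rfl
    simp only [h1]
    rw [ContinuousLinearMap.comp_apply, ← zero_add (𝒯 s (𝒯 t v))]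
    refine Tendsto.add ?_ (h𝒯 s hs _)
    rw [tendsto_zero_iff_norm_tendsto_zero]
    refine squeeze_zero (fun _ => norm_nonneg _) (fun k => norm_exp_apply_le (hdis k) hs _) ?_
    exact tendsto_iff_norm_sub_tendsto_zero.1 (h𝒯 t ht v)
  have hgen : ∀ x y, (x, y) ∈ A.graph →
      Tendsto (fun t : ℝ => (t : ℂ)⁻¹ • (𝒯 t x - x)) (𝓝[>] 0) (𝓝 y) := by
    intro x y h
    rw [Metric.tendsto_nhds]
    intro ε hε
    obtain ⟨z, hz, hyz⟩ := hd.exists_dist_lt y (show 0 < ε / 4 by positivity)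
    set w := A ⟨z, hz⟩
    have hsmall : ∀ᶠ t : ℝ in 𝓝[>] 0, t * ‖w‖ < ε / 2 := by
      have : Tendsto (fun t : ℝ => t * ‖w‖) (𝓝 0) (𝓝 (0 * ‖w‖)) := tendsto_id.mul_const _
      rw [zero_mul] at this
      exact (this.mono_left nhdsWithin_le_nhds).eventually_lt_const (by positivity)
    filter_upwards [hsmall, self_mem_nhdsWithin] with t h1 ht
    have ht' : 0 < t := ht
    have h2 : ‖𝒯 t x - x - t • y‖ ≤ t * (2 * ‖y - z‖ + t * ‖w‖) := by
      refine le_of_tendsto_of_tendsto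
        (((h𝒯 t ht'.le x).sub_const x).sub ((hYlim x y h).const_smul t)).norm
        (Tendsto.const_mul t ((((hYlim x y h).sub_const z).norm.const_mul 2).add
          ((hYlim z w (A.mem_graph ⟨z, hz⟩)).norm.const_mul t)))
        (Eventually.of_forall fun k => norm_exp_apply_sub_sub_le (hdis k) ht'.le x z)
    have h3 : (t : ℂ)⁻¹ • (𝒯 t x - x) - y = (t : ℂ)⁻¹ • (𝒯 t x - x - t • y) := by
      rw [smul_sub _ _ (t • y), ← Complex.coe_smul t y, smul_smul,
        inv_mul_cancel₀ (by exact_mod_cast ht'.ne'), one_smul]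
    rw [dist_eq_norm, h3, norm_smul, norm_inv, Complex.norm_real, Real.norm_of_nonneg ht'.le,
      inv_mul_lt_iff₀ ht']
    refine h2.trans_lt (mul_lt_mul_of_pos_left ?_ ht')
    rw [dist_eq_norm] at hyz
    linarith
  refine ⟨𝒯, ⟨hzero, hadd, hlim0⟩, fun x y => ⟨hgen x y, fun h => ?_⟩⟩
  -- The generator extends `A`; it is no larger. Solving `(lam - A) x' = lam x - y` gives `y - y' =
  -- lam (x - x')`, while contractivity of `𝒯` gives `Re ⟨y - y', x - x'⟩ ≤ 0`, so `x = x'`.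
  have hxy := (hG 0).mem_graph ((lam 0 : ℂ) • x - y)
  set x' := G 0 ((lam 0 : ℂ) • x - y)
  set y' := (lam 0 : ℂ) • x' - ((lam 0 : ℂ) • x - y) with hy'
  have hdiff := h.sub (hgen x' y' hxy)
  have hyy : y - y' = (lam 0 : ℂ) • (x - x') := by rw [hy', smul_sub]; abel
  have hle : (⟪y - y', x - x'⟫_ℂ).re ≤ 0 := by
    have hlim : Tendsto (fun t : ℝ => (⟪(t : ℂ)⁻¹ • (𝒯 t x - x) - (t : ℂ)⁻¹ • (𝒯 t x' - x'),
        x - x'⟫_ℂ).re) (𝓝[>] 0) (𝓝 (⟪y - y', x - x'⟫_ℂ).re) :=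
      (Complex.continuous_re.tendsto _).comp (hdiff.inner tendsto_const_nhds)
    refine le_of_tendsto hlim ?_
    filter_upwards [self_mem_nhdsWithin] with t ht
    have ht' : 0 < t := ht
    have h1 : (t : ℂ)⁻¹ • (𝒯 t x - x) - (t : ℂ)⁻¹ • (𝒯 t x' - x') =
        ((t⁻¹ : ℝ) : ℂ) • (𝒯 t (x - x') - (x - x')) := by
      rw [← smul_sub, map_sub, Complex.ofReal_inv]
      congr 1
      abel
    rw [h1, inner_smul_left, Complex.conj_ofReal, Complex.re_ofReal_mul, inner_sub_left,
      Complex.sub_re]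
    have h2 : (⟪𝒯 t (x - x'), x - x'⟫_ℂ).re ≤ ‖𝒯 t (x - x')‖ * ‖x - x'‖ :=
      re_inner_le_norm (𝕜 := ℂ) _ _
    have h3 : (⟪x - x', x - x'⟫_ℂ).re = ‖x - x'‖ ^ 2 := by
      simpa using re_inner_real_smul_self 1 (x - x')
    refine mul_nonpos_of_nonneg_of_nonpos (by positivity) ?_
    nlinarith [hcontr t ht'.le (x - x'), norm_nonneg (x - x')]
  rw [hyy, re_inner_real_smul_self] at hle
  have hxx : x = x' := by
    have h4 : ‖x - x'‖ ^ 2 ≤ 0 := by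
      by_contra hc
      push Not at hc
      nlinarith [mul_pos (hpos 0) hc]
    have : ‖x - x'‖ = 0 := by simpa using le_antisymm h4 (sq_nonneg _)
    exact sub_eq_zero.1 (norm_eq_zero.1 this)
  rw [← hxx, sub_self, smul_zero, sub_eq_zero] at hyy
  rwa [← hxx, ← hyy] at hxy

end HilleYosida

/-! ### General properties of semigroups and their generators. -/

theorem IsC0Semigroup.apply_zero {𝒯 : ℝ → E →L[ℂ] E} (h𝒯 : IsC0Semigroup 𝒯) (x : E) :
    𝒯 0 x = x := by rw [h𝒯.zero]; rfl

theorem IsC0Semigroup.apply_add {𝒯 : ℝ → E →L[ℂ] E} (h𝒯 : IsC0Semigroup 𝒯) {s t : ℝ}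
    (hs : 0 ≤ s) (ht : 0 ≤ t) (x : E) : 𝒯 (s + t) x = 𝒯 s (𝒯 t x) := by
  rw [h𝒯.add s t hs ht]; rfl

theorem IsC0Semigroup.tendsto_Ici {𝒯 : ℝ → E →L[ℂ] E} (h𝒯 : IsC0Semigroup 𝒯) (x : E) :
    Tendsto (fun t => 𝒯 t x) (𝓝[≥] 0) (𝓝 x) := by
  rw [← Ioi_insert, nhdsWithin_insert, tendsto_sup]
  refine ⟨?_, h𝒯.tendsto x⟩
  rw [tendsto_pure_left]
  intro s hs
  rw [h𝒯.apply_zero]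
  exact mem_of_mem_nhds hs

/-- Otherwise some `tₙ → 0` has `‖𝒯 tₙ‖ → ∞`, although every orbit `𝒯 tₙ x` converges; this
contradicts Banach–Steinhaus. -/
theorem IsC0Semigroup.exists_norm_le_near_zero [CompleteSpace E] {𝒯 : ℝ → E →L[ℂ] E}
    (h𝒯 : IsC0Semigroup 𝒯) : ∃ δ > 0, ∃ M, 1 ≤ M ∧ ∀ t, 0 ≤ t → t ≤ δ → ‖𝒯 t‖ ≤ M := by
  by_contra! hcon
  have hex : ∀ n : ℕ, ∃ t, 0 ≤ t ∧ t ≤ 1 / ((n : ℝ) + 1) ∧ (n : ℝ) + 1 < ‖𝒯 t‖ := fun n =>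
    hcon (1 / ((n : ℝ) + 1)) (by positivity) ((n : ℝ) + 1) (by simp)
  choose t ht0 ht1 htn using hex
  have hlim : Tendsto t atTop (𝓝[≥] 0) := by
    refine tendsto_nhdsWithin_iff.2 ⟨?_, Eventually.of_forall ht0⟩
    exact squeeze_zero ht0 ht1 tendsto_one_div_add_atTop_nhds_zero_nat
  obtain ⟨C, hC⟩ := banach_steinhaus (g := fun n => 𝒯 (t n)) fun x => by
    obtain ⟨C, hC⟩ := ((h𝒯.tendsto_Ici x).comp hlim).norm.bddAbove_range
    exact ⟨C, fun n => hC ⟨n, rfl⟩⟩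
  obtain ⟨n, hn⟩ := exists_nat_gt C
  linarith [hC n, htn n]

theorem IsC0Semigroup.exists_norm_le [CompleteSpace E] {𝒯 : ℝ → E →L[ℂ] E}
    (h𝒯 : IsC0Semigroup 𝒯) (b : ℝ) : ∃ C, ∀ t, 0 ≤ t → t ≤ b → ‖𝒯 t‖ ≤ C := by
  obtain ⟨δ, hδ, M, hM, hbd⟩ := h𝒯.exists_norm_le_near_zero
  have key : ∀ n : ℕ, ∀ t, 0 ≤ t → t ≤ n * δ → ‖𝒯 t‖ ≤ M ^ (n + 1) := by
    intro n
    induction n with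
    | zero =>
      intro t h0 h1
      simp only [Nat.cast_zero, zero_mul, zero_add, pow_one] at *
      exact hbd t h0 (h1.trans hδ.le)
    | succ n ih =>
      intro t h0 h1
      rcases le_or_gt t δ with h | h
      · exact (hbd t h0 h).trans (le_self_pow₀ hM (by omega))
      · push_cast at h1
        have h2 := h𝒯.add δ (t - δ) hδ.le (by linarith)
        rw [add_sub_cancel] at h2
        rw [h2, pow_succ']
        refine (ContinuousLinearMap.opNorm_comp_le _ _).trans ?_
        exact mul_le_mul (hbd δ hδ.le le_rfl) (ih _ (by linarith) (by linarith))
          (norm_nonneg _) (by linarith)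
  obtain ⟨n, hn⟩ := exists_nat_ge (b / δ)
  exact ⟨M ^ (n + 1), fun t h0 h1 => key n t h0 (h1.trans ((div_le_iff₀ hδ).1 hn))⟩

theorem IsC0Semigroup.continuousOn [CompleteSpace E] {𝒯 : ℝ → E →L[ℂ] E}
    (h𝒯 : IsC0Semigroup 𝒯) (x : E) : ContinuousOn (fun t => 𝒯 t x) (Ici 0) := by
  intro t₀ ht₀
  obtain ⟨C, hC⟩ := h𝒯.exists_norm_le (t₀ + 1)
  -- Factoring out the earlier time leaves an increment over `|b - a|`, so right continuity at `0`
  -- gives continuity from both sides.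
  have key : ∀ a b, 0 ≤ a → a ≤ b → a ≤ t₀ + 1 → ‖𝒯 b x - 𝒯 a x‖ ≤ C * ‖𝒯 |b - a| x - x‖ := by
    intro a b ha hab ha1
    rw [abs_of_nonneg (sub_nonneg.2 hab)]
    have h1 := h𝒯.apply_add ha (sub_nonneg.2 hab) x
    rw [add_sub_cancel] at h1
    rw [h1, ← map_sub]
    exact (𝒯 a).le_of_opNorm_le (hC a ha ha1) _
  have habs : Tendsto (fun t => |t - t₀|) (𝓝[Ici 0] t₀) (𝓝[≥] 0) := by
    refine tendsto_nhdsWithin_iff.2 ⟨?_, Eventually.of_forall fun t => mem_Ici.2 (abs_nonneg _)⟩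
    have : Tendsto (fun t => |t - t₀|) (𝓝 t₀) (𝓝 |t₀ - t₀|) :=
      (Continuous.tendsto (by fun_prop) t₀)
    rw [sub_self, abs_zero] at this
    exact this.mono_left nhdsWithin_le_nhds
  have hz : Tendsto (fun t => C * ‖𝒯 |t - t₀| x - x‖) (𝓝[Ici 0] t₀) (𝓝 0) := by
    have h1 := tendsto_iff_norm_sub_tendsto_zero.1 ((h𝒯.tendsto_Ici x).comp habs)
    have h2 := h1.const_mul C
    rw [mul_zero] at h2
    exact h2
  refine tendsto_iff_norm_sub_tendsto_zero.2
    (squeeze_zero' (Eventually.of_forall fun _ => norm_nonneg _) ?_ hz)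
  have hnear : ∀ᶠ t in 𝓝[Ici 0] t₀, t ≤ t₀ + 1 :=
    nhdsWithin_le_nhds (Iic_mem_nhds (by linarith))
  filter_upwards [hnear, self_mem_nhdsWithin] with t h1 h0
  rcases le_total t₀ t with h | h
  · exact key t₀ t ht₀ h (by linarith)
  · have := key t t₀ h0 h h1
    rwa [norm_sub_rev, abs_sub_comm] at this

theorem IsGenerator.mem_graph_apply {A : E →ₗ.[ℂ] E} {𝒯 : ℝ → E →L[ℂ] E}
    (hA : IsGenerator A 𝒯) (h𝒯 : IsC0Semigroup 𝒯) {x y : E} (h : (x, y) ∈ A.graph) {t : ℝ}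
    (ht : 0 ≤ t) : (𝒯 t x, 𝒯 t y) ∈ A.graph := by
  rw [hA] at h ⊢
  have h1 := ((𝒯 t).continuous.tendsto y).comp h
  refine h1.congr' ?_
  filter_upwards [self_mem_nhdsWithin] with s hs
  simp only [Function.comp_apply, map_smul, map_sub]
  rw [← h𝒯.apply_add ht (le_of_lt hs), add_comm, h𝒯.apply_add (le_of_lt hs) ht]

theorem IsGenerator.commute_resolvent {A : E →ₗ.[ℂ] E} {𝒯 : ℝ → E →L[ℂ] E}
    (hA : IsGenerator A 𝒯) (h𝒯 : IsC0Semigroup 𝒯) {lam : ℝ} {G : E →L[ℂ] E}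
    (hG : IsResolvent A lam G) {t : ℝ} (ht : 0 ≤ t) (v : E) : 𝒯 t (G v) = G (𝒯 t v) := by
  have h := (hG _ _).1 (hA.mem_graph_apply h𝒯 (hG.mem_graph v) ht)
  rw [← map_smul, ← map_sub, sub_sub_cancel] at h
  exact h.symm

theorem hasDerivWithinAt_of_tendsto_right {y : ℝ → E} {y' : E} {t : ℝ}
    (h : Tendsto (fun s : ℝ => (s : ℂ)⁻¹ • (y (t + s) - y t)) (𝓝[>] 0) (𝓝 y')) :
    HasDerivWithinAt y y' (Ici t) t := by
  rw [← hasDerivWithinAt_Ioi_iff_Ici, hasDerivWithinAt_iff_tendsto_slope' (by simp)]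
  have h1 : Tendsto (fun s : ℝ => s - t) (𝓝[>] t) (𝓝[>] 0) := by
    refine tendsto_nhdsWithin_iff.2 ⟨?_, ?_⟩
    · have : Tendsto (fun s : ℝ => s - t) (𝓝 t) (𝓝 (t - t)) := (Continuous.tendsto (by fun_prop) t)
      rw [sub_self] at this
      exact this.mono_left nhdsWithin_le_nhds
    · filter_upwards [self_mem_nhdsWithin] with s hs
      exact sub_pos.2 (mem_Ioi.1 hs)
  refine (h.comp h1).congr fun s => ?_
  simp only [Function.comp_apply, slope, vsub_eq_sub, add_sub_cancel]
  rw [← Complex.coe_smul, Complex.ofReal_inv]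

/-- Proved from the generator alone, because `semigroup A` is a chosen object known only through its
defining properties. On `dom A` the squared norm of the orbit has non-positive right derivative. -/
theorem IsGenerator.norm_apply_le [CompleteSpace E] {A : E →ₗ.[ℂ] E} {𝒯 : ℝ → E →L[ℂ] E}
    (hA : IsGenerator A 𝒯) (h𝒯 : IsC0Semigroup 𝒯) (hdis : IsDissipative A)
    (hd : Dense (A.domain : Set E)) {t : ℝ} (ht : 0 ≤ t) (v : E) : ‖𝒯 t v‖ ≤ ‖v‖ := by
  have hdom : ∀ x ∈ (A.domain : Set E), ‖𝒯 t x‖ ≤ ‖x‖ := by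
    intro x hx
    have hxy := A.mem_graph ⟨x, hx⟩
    set y := A ⟨x, hx⟩
    have hder : ∀ s ∈ Ico 0 t, HasDerivWithinAt (fun s => ‖𝒯 s x‖ ^ 2)
        (2 * (⟪𝒯 s y, 𝒯 s x⟫_ℂ).re) (Ici s) s := by
      intro s hs
      refine hasDerivWithinAt_norm_sq (hasDerivWithinAt_of_tendsto_right ?_)
      refine ((hA _ _).1 (hA.mem_graph_apply h𝒯 hxy hs.1)).congr' ?_
      filter_upwards [self_mem_nhdsWithin] with r hr
      rw [add_comm s r, h𝒯.apply_add (le_of_lt hr) hs.1]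
    have hcont : ContinuousOn (fun s => ‖𝒯 s x‖ ^ 2) (Icc 0 t) :=
      (((h𝒯.continuousOn x).mono Icc_subset_Ici_self).norm).pow 2
    have h := image_le_of_deriv_right_le_deriv_boundary hcont hder (B := fun _ => ‖x‖ ^ 2)
      (B' := fun _ => 0) (by rw [h𝒯.apply_zero]) continuousOn_const
      (fun s _ => hasDerivWithinAt_const _ _ _)
      (fun s hs => by
        have := hdis _ _ (hA.mem_graph_apply h𝒯 hxy hs.1)
        linarith) ⟨ht, le_rfl⟩
    exact le_of_sq_le_sq h (norm_nonneg _)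
  refine hd.induction hdom ?_ v
  exact isClosed_le (by fun_prop) (by fun_prop)

/-- A strongly continuous semigroup of contractions. -/
structure IsContractionSemigroup (𝒯 : ℝ → E →L[ℂ] E) : Prop extends IsC0Semigroup 𝒯 where
  norm_apply_le : ∀ t, 0 ≤ t → ∀ v, ‖𝒯 t v‖ ≤ ‖v‖

/-- Joint continuity follows from strong continuity in time and the uniform Lipschitz bound in
space. It supplies measurability and continuity of the Duhamel kernel. -/
theorem IsContractionSemigroup.continuous [CompleteSpace E] {𝒯 : ℝ → E →L[ℂ] E}
    (h𝒯 : IsContractionSemigroup 𝒯) : Continuous fun p : ℝ × E => 𝒯 (max p.1 0) p.2 := by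
  refine continuous_prod_of_continuous_lipschitzWith' _ 1 (fun t => ?_) fun x => ?_
  · refine LipschitzWith.of_dist_le_mul fun v w => ?_
    rw [dist_eq_norm, dist_eq_norm, ← map_sub, NNReal.coe_one, one_mul]
    exact h𝒯.norm_apply_le _ (le_max_right _ _) _
  · exact (h𝒯.toIsC0Semigroup.continuousOn x).comp_continuous (by fun_prop)
      fun t => mem_Ici.2 (le_max_right _ _)

/-! ### Energy balance for regular solutions. -/

theorem eval_eq_of_mem_graph {S : E →ₗ.[ℂ] E} {x w : E} (h : (x, w) ∈ S.graph) :
    eval S x = w := by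
  have hx := LinearPMap.mem_domain_of_mem_graph h
  rw [eval, dif_pos hx]
  exact S.mem_graph_snd_inj (S.mem_graph ⟨x, hx⟩) h rfl

/-- `Re ⟨A x, x⟩ = -‖S x‖²` on `dom A ⊆ dom S`. -/
def IsDissipationRoot (A S : E →ₗ.[ℂ] E) : Prop :=
  ∀ x y, (x, y) ∈ A.graph → (x, eval S x) ∈ S.graph ∧ (⟪y, x⟫_ℂ).re = -‖eval S x‖ ^ 2

theorem isDissipationRoot_sub [CompleteSpace E] {J R S : E →ₗ.[ℂ] E} (hJ : IsSkewAdjoint J)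
    (hS : IsPosSqrt R S) : IsDissipationRoot (J - R) S := by
  intro x y h
  obtain ⟨z, r, hz, hr, rfl⟩ := mem_graph_sub.1 h
  obtain ⟨w, hw, hwr⟩ := (hS.2 _ _).1 hr
  have h1 := congrArg Complex.re (hS.1.inner_eq hwr hw)
  have h2 : (⟪w, w⟫_ℂ).re = ‖w‖ ^ 2 := by simpa using re_inner_real_smul_self 1 w
  rw [eval_eq_of_mem_graph hw]
  refine ⟨hw, ?_⟩
  rw [inner_sub_left, Complex.sub_re, hJ.re_inner_eq_zero hz, h1, h2, zero_sub]

/-- `z` solves `z' = A z + g` on `[0, ∞)` with one-sided derivatives, where `a = A z`. -/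
structure IsRegularSolution (A : E →ₗ.[ℂ] E) (z a g : ℝ → E) : Prop where
  continuousOn : ContinuousOn z (Ici 0)
  continuousOn_op : ContinuousOn a (Ici 0)
  continuousOn_rhs : ContinuousOn g (Ici 0)
  mem_graph : ∀ t, 0 ≤ t → (z t, a t) ∈ A.graph
  hasDeriv : ∀ t, 0 ≤ t → HasDerivWithinAt z (a t + g t) (Ici t) t

theorem IsRegularSolution.sub {A : E →ₗ.[ℂ] E} {z a g z' a' g' : ℝ → E}
    (h : IsRegularSolution A z a g) (h' : IsRegularSolution A z' a' g') :
    IsRegularSolution A (fun t => z t - z' t) (fun t => a t - a' t) (fun t => g t - g' t) where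
  continuousOn := h.continuousOn.sub h'.continuousOn
  continuousOn_op := h.continuousOn_op.sub h'.continuousOn_op
  continuousOn_rhs := h.continuousOn_rhs.sub h'.continuousOn_rhs
  mem_graph t ht := A.graph.sub_mem (h.mem_graph t ht) (h'.mem_graph t ht)
  hasDeriv t ht := by
    rw [sub_add_sub_comm]
    exact (h.hasDeriv t ht).fun_sub (h'.hasDeriv t ht)

theorem IsDissipationRoot.eval_sub {A S : E →ₗ.[ℂ] E} (hS : IsDissipationRoot A S)
    {x y x' y' : E} (h : (x, y) ∈ A.graph) (h' : (x', y') ∈ A.graph) :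
    eval S (x - x') = eval S x - eval S x' :=
  eval_eq_of_mem_graph (S.graph.sub_mem (hS x y h).1 (hS x' y' h').1)

/-- By linearity `‖S (z s) - S (z t)‖² = -Re ⟨a s - a t, z s - z t⟩`, so continuity of `z` and `A z`
passes to `S z`. -/
theorem IsRegularSolution.continuousOn_eval {A S : E →ₗ.[ℂ] E} (hS : IsDissipationRoot A S)
    {z a g : ℝ → E} (h : IsRegularSolution A z a g) :
    ContinuousOn (fun t => eval S (z t)) (Ici 0) := by
  intro t ht
  have h1 : Tendsto (fun s => -(⟪a s - a t, z s - z t⟫_ℂ).re) (𝓝[Ici 0] t) (𝓝 0) := by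
    have h2 : ContinuousWithinAt (fun s => -(⟪a s - a t, z s - z t⟫_ℂ).re) (Ici 0) t :=
      (Complex.continuous_re.continuousAt.comp_continuousWithinAt
        (((h.continuousOn_op t ht).sub continuousWithinAt_const).inner (𝕜 := ℂ)
          ((h.continuousOn t ht).sub continuousWithinAt_const))).neg
    simpa [ContinuousWithinAt] using h2
  have h3 : Tendsto (fun s => ‖eval S (z s) - eval S (z t)‖ ^ 2) (𝓝[Ici 0] t) (𝓝 0) := by
    refine h1.congr' ?_
    filter_upwards [self_mem_nhdsWithin] with s hs
    have hsub := A.graph.sub_mem (h.mem_graph s hs) (h.mem_graph t ht)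
    rw [← hS.eval_sub (h.mem_graph s hs) (h.mem_graph t ht), (hS _ _ hsub).2, neg_neg]
  refine tendsto_iff_norm_sub_tendsto_zero.2 ?_
  have h4 := h3.sqrt
  simpa [Real.sqrt_sq (norm_nonneg _)] using h4

theorem continuousOn_re_inner {a b : ℝ → E} {s : Set ℝ} (ha : ContinuousOn a s)
    (hb : ContinuousOn b s) : ContinuousOn (fun t => (⟪a t, b t⟫_ℂ).re) s :=
  Complex.continuous_re.comp_continuousOn (ContinuousOn.inner (𝕜 := ℂ) ha hb)

theorem intervalIntegrable_of_continuousOn_Ici {F : Type*} [NormedAddCommGroup F] {f : ℝ → F}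
    (hf : ContinuousOn f (Ici 0)) {T : ℝ} (hT : 0 ≤ T) : IntervalIntegrable f volume 0 T :=
  (hf.mono (by rw [uIcc_of_le hT]; exact Icc_subset_Ici_self)).intervalIntegrable

theorem IsRegularSolution.energy {A S : E →ₗ.[ℂ] E} (hS : IsDissipationRoot A S)
    {z a g : ℝ → E} (h : IsRegularSolution A z a g) {T : ℝ} (hT : 0 ≤ T) :
    ∫ t in (0 : ℝ)..T, (⟪g t, z t⟫_ℂ).re =
      hamiltonian (z T) - hamiltonian (z 0) + ∫ t in (0 : ℝ)..T, ‖eval S (z t)‖ ^ 2 := by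
  have hg : ContinuousOn (fun t => (⟪g t, z t⟫_ℂ).re) (Ici 0) :=
    continuousOn_re_inner h.continuousOn_rhs h.continuousOn
  have hw : ContinuousOn (fun t => ‖eval S (z t)‖ ^ 2) (Ici 0) :=
    (h.continuousOn_eval hS).norm.pow 2
  have hgi := intervalIntegrable_of_continuousOn_Ici hg hT
  have hwi := intervalIntegrable_of_continuousOn_Ici hw hT
  have hder : ∀ t ∈ Ioo 0 T, HasDerivWithinAt (fun t => hamiltonian (z t))
      ((⟪g t, z t⟫_ℂ).re - ‖eval S (z t)‖ ^ 2) (Ioi t) t := by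
    intro t ht
    have h1 := (hasDerivWithinAt_norm_sq
      ((h.hasDeriv t ht.1.le).mono Ioi_subset_Ici_self)).const_mul (1 / 2)
    have h2 : 1 / 2 * (2 * (⟪a t + g t, z t⟫_ℂ).re) =
        (⟪g t, z t⟫_ℂ).re - ‖eval S (z t)‖ ^ 2 := by
      rw [inner_add_left, Complex.add_re, (hS _ _ (h.mem_graph t ht.1.le)).2]
      ring
    rwa [h2] at h1
  have hcont : ContinuousOn (fun t => hamiltonian (z t)) (Icc 0 T) :=
    ((h.continuousOn.mono Icc_subset_Ici_self).norm.pow 2).const_mul _ |>.congr fun _ _ => rfl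
  have key := intervalIntegral.integral_eq_sub_of_hasDeriv_right_of_le hT hcont hder (hgi.sub hwi)
  rw [intervalIntegral.integral_sub hgi hwi] at key
  linarith

/-! ### The variation of constants formula. -/

section Duhamel

/-- `𝒯(t) x₀ + ∫₀ᵗ 𝒯(t - s) f(s) ds`. -/
def duhamel (𝒯 : ℝ → E →L[ℂ] E) (x₀ : E) (f : ℝ → E) (t : ℝ) : E :=
  𝒯 t x₀ + ∫ s in (0 : ℝ)..t, 𝒯 (t - s) (f s)

variable {𝒯 : ℝ → E →L[ℂ] E}

theorem integral_max_eq (f : ℝ → E) {a t : ℝ} (ht : a ≤ t) :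
    ∫ s in a..t, 𝒯 (t - s) (f s) = ∫ s in a..t, 𝒯 (max (t - s) 0) (f s) := by
  refine intervalIntegral.integral_congr fun s hs => ?_
  rw [uIcc_of_le ht] at hs
  rw [max_eq_left (sub_nonneg.2 hs.2)]

variable [CompleteSpace E]

theorem IsContractionSemigroup.intervalIntegrable (h𝒯 : IsContractionSemigroup 𝒯) {f : ℝ → E}
    {T : ℝ} (hf : IntegrableOn f (Ioc 0 T)) {t : ℝ} (ht : t ∈ Icc 0 T) :
    IntervalIntegrable (fun s => 𝒯 (max (t - s) 0) (f s)) volume 0 t := by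
  rw [intervalIntegrable_iff_integrableOn_Ioc_of_le ht.1]
  have hf' : IntegrableOn f (Ioc 0 t) := hf.mono_set (Ioc_subset_Ioc_right ht.2)
  refine Integrable.mono hf' ?_ (Eventually.of_forall fun s => ?_)
  · have h1 : AEStronglyMeasurable (fun s : ℝ => (t - s, f s)) (volume.restrict (Ioc 0 t)) :=
      (Continuous.aestronglyMeasurable (by fun_prop)).prodMk hf'.aestronglyMeasurable
    exact h𝒯.continuous.comp_aestronglyMeasurable h1
  · exact h𝒯.norm_apply_le _ (le_max_right _ _) _

theorem IsContractionSemigroup.norm_duhamel_sub_le (h𝒯 : IsContractionSemigroup 𝒯) (x₀ : E)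
    {f g : ℝ → E} {T : ℝ} (hf : IntegrableOn f (Ioc 0 T)) (hg : IntegrableOn g (Ioc 0 T)) {t : ℝ}
    (ht : t ∈ Icc 0 T) :
    ‖duhamel 𝒯 x₀ f t - duhamel 𝒯 x₀ g t‖ ≤ ∫ s in Ioc 0 T, ‖f s - g s‖ := by
  rw [duhamel, duhamel, add_sub_add_left_eq_sub, integral_max_eq f ht.1, integral_max_eq g ht.1,
    ← intervalIntegral.integral_sub (h𝒯.intervalIntegrable hf ht) (h𝒯.intervalIntegrable hg ht),
    intervalIntegral.integral_of_le ht.1]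
  have hfg : IntegrableOn (fun s => ‖f s - g s‖) (Ioc 0 T) := (hf.sub hg).norm
  refine (norm_integral_le_of_norm_le (hfg.mono_set (Ioc_subset_Ioc_right ht.2))
    (Eventually.of_forall fun s => ?_)).trans
    (setIntegral_mono_set hfg (Eventually.of_forall fun s => norm_nonneg _)
      (Ioc_subset_Ioc_right ht.2).eventuallyLE)
  rw [← map_sub]
  exact h𝒯.norm_apply_le _ (le_max_right _ _) _

theorem IsContractionSemigroup.norm_duhamel_le (h𝒯 : IsContractionSemigroup 𝒯) (x₀ : E)
    {f : ℝ → E} {T : ℝ} (hf : IntegrableOn f (Ioc 0 T)) {t : ℝ} (ht : t ∈ Icc 0 T) :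
    ‖duhamel 𝒯 x₀ f t‖ ≤ ‖x₀‖ + ∫ s in Ioc 0 T, ‖f s‖ := by
  have h1 := h𝒯.norm_duhamel_sub_le x₀ hf (g := fun _ => 0) (by simp) ht
  have h2 : duhamel 𝒯 x₀ (fun _ => 0) t = 𝒯 t x₀ := by simp [duhamel]
  simp only [h2, sub_zero] at h1
  have h3 := h𝒯.norm_apply_le t ht.1 x₀
  have h4 := norm_add_le (duhamel 𝒯 x₀ f t - 𝒯 t x₀) (𝒯 t x₀)
  rw [sub_add_cancel] at h4
  linarith

theorem IsContractionSemigroup.continuous_kernel (h𝒯 : IsContractionSemigroup 𝒯) {f : ℝ → E}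
    (hf : Continuous f) : Continuous fun p : ℝ × ℝ => 𝒯 (max (p.1 - p.2) 0) (f p.2) :=
  h𝒯.continuous.comp (f := fun p : ℝ × ℝ => (p.1 - p.2, f p.2)) (by fun_prop)

theorem IsContractionSemigroup.continuousOn_duhamel (h𝒯 : IsContractionSemigroup 𝒯) (x₀ : E)
    {f : ℝ → E} (hf : Continuous f) : ContinuousOn (duhamel 𝒯 x₀ f) (Ici 0) := by
  have h1 : Continuous fun t => 𝒯 (max t 0) x₀ + ∫ s in (0 : ℝ)..t, 𝒯 (max (t - s) 0) (f s) := by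
    refine Continuous.add ?_ ?_
    · exact h𝒯.continuous.comp (f := fun t : ℝ => (t, x₀)) (by fun_prop)
    · exact intervalIntegral.continuous_parametric_intervalIntegral_of_continuous
        (f := fun t s => 𝒯 (max (t - s) 0) (f s)) (h𝒯.continuous_kernel hf) continuous_id
  refine h1.continuousOn.congr fun t ht => ?_
  beta_reduce
  rw [duhamel, integral_max_eq f ht, max_eq_left (mem_Ici.1 ht)]

theorem IsContractionSemigroup.duhamel_add (h𝒯 : IsContractionSemigroup 𝒯) (x₀ : E)
    {f : ℝ → E} (hf : Continuous f) {t h : ℝ} (ht : 0 ≤ t) (hh : 0 ≤ h) :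
    duhamel 𝒯 x₀ f (t + h) =
      𝒯 h (duhamel 𝒯 x₀ f t) + ∫ s in t..t + h, 𝒯 (max (t + h - s) 0) (f s) := by
  have hint : ∀ a b : ℝ, IntervalIntegrable (fun s => 𝒯 (max (t + h - s) 0) (f s)) volume a b :=
    fun a b => ((h𝒯.continuous_kernel hf).comp
      (f := fun s : ℝ => (t + h, s)) (by fun_prop)).intervalIntegrable a b
  have hint' : IntervalIntegrable (fun s => 𝒯 (max (t - s) 0) (f s)) volume 0 t :=
    ((h𝒯.continuous_kernel hf).comp
      (f := fun s : ℝ => (t, s)) (by fun_prop)).intervalIntegrable 0 t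
  rw [duhamel, duhamel, integral_max_eq f (add_nonneg ht hh), integral_max_eq f ht,
    ← intervalIntegral.integral_add_adjacent_intervals (hint 0 t) (hint t (t + h)), map_add,
    ← h𝒯.apply_add hh ht, add_comm t h, ← add_assoc,
    ← ContinuousLinearMap.intervalIntegral_comp_comm _ hint']
  congr 2
  refine intervalIntegral.integral_congr fun s hs => ?_
  rw [uIcc_of_le ht] at hs
  rw [max_eq_left (sub_nonneg.2 hs.2), max_eq_left (by linarith [hs.2]),
    ← h𝒯.apply_add hh (sub_nonneg.2 hs.2), add_sub_assoc]

/-- The substitution `s = t + h r` turns the average into an integral over `[0, 1]`, continuous in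
`h` down to `h = 0`, where the integrand is constantly `f t`. -/
theorem IsContractionSemigroup.tendsto_average (h𝒯 : IsContractionSemigroup 𝒯)
    {f : ℝ → E} (hf : Continuous f) (t : ℝ) :
    Tendsto (fun h : ℝ => (h : ℂ)⁻¹ • ∫ s in t..t + h, 𝒯 (max (t + h - s) 0) (f s)) (𝓝[>] 0)
      (𝓝 (f t)) := by
  have hcont : Continuous fun h : ℝ => ∫ r in (0 : ℝ)..1,
      𝒯 (max (t + h - (t + h * r)) 0) (f (t + h * r)) := by
    refine intervalIntegral.continuous_parametric_intervalIntegral_of_continuous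
      (f := fun h r : ℝ => 𝒯 (max (t + h - (t + h * r)) 0) (f (t + h * r))) ?_ continuous_const
    exact (h𝒯.continuous_kernel hf).comp
      (f := fun p : ℝ × ℝ => (t + p.1, t + p.1 * p.2)) (by fun_prop)
  have h0 := hcont.tendsto 0
  simp only [zero_mul, add_zero, sub_self, max_self, h𝒯.apply_zero,
    intervalIntegral.integral_const, sub_zero, one_smul] at h0
  refine (h0.mono_left nhdsWithin_le_nhds).congr' ?_
  filter_upwards [self_mem_nhdsWithin] with h hh
  have h1 := intervalIntegral.smul_integral_comp_add_mul
    (f := fun s => 𝒯 (max (t + h - s) 0) (f s)) (a := 0) (b := 1) h t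
  rw [mul_zero, add_zero, mul_one] at h1
  rw [← h1, ← Complex.coe_smul, smul_smul,
    inv_mul_cancel₀ (by exact_mod_cast (mem_Ioi.1 hh).ne'), one_smul]

/-- The factor `lam G` pushes the mild solution into `dom A`. By `duhamel_add` its right difference
quotient splits into that of the semigroup, with limit given by the generator, and an average of the
forcing. -/
theorem IsContractionSemigroup.isRegularSolution (h𝒯 : IsContractionSemigroup 𝒯)
    {A : E →ₗ.[ℂ] E} (hA : IsGenerator A 𝒯) {lam : ℝ} {G : E →L[ℂ] E} (hG : IsResolvent A lam G)
    (x₀ : E) {f : ℝ → E} (hf : Continuous f) :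
    IsRegularSolution A (fun t => (lam : ℂ) • G (duhamel 𝒯 x₀ f t))
      (fun t => yosida lam G (duhamel 𝒯 x₀ f t)) (fun t => (lam : ℂ) • G (f t)) where
  continuousOn := (G.continuous.comp_continuousOn (h𝒯.continuousOn_duhamel x₀ hf)).const_smul _
  continuousOn_op := (yosida lam G).continuous.comp_continuousOn (h𝒯.continuousOn_duhamel x₀ hf)
  continuousOn_rhs := ((G.continuous.comp hf).const_smul _).continuousOn
  mem_graph t _ := A.graph.smul_mem (lam : ℂ) (hG.mem_graph (duhamel 𝒯 x₀ f t))
  hasDeriv t ht := by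
    refine hasDerivWithinAt_of_tendsto_right ?_
    have h1 := (hA _ _).1 (A.graph.smul_mem (lam : ℂ) (hG.mem_graph (duhamel 𝒯 x₀ f t)))
    have h2 := (((lam : ℂ) • G).continuous.tendsto (f t)).comp (h𝒯.tendsto_average hf t)
    refine (h1.add h2).congr' ?_
    filter_upwards [self_mem_nhdsWithin] with h hh
    have hh' : 0 ≤ h := le_of_lt hh
    rw [h𝒯.duhamel_add x₀ hf ht hh', map_add, ← hA.commute_resolvent h𝒯.toIsC0Semigroup hG hh']
    simp only [Function.comp_apply, map_smul, _root_.smul_apply]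
    rw [← smul_add, smul_add (lam : ℂ)]
    congr 1
    abel

end Duhamel

/-! ### Limits in `L²` and in the energy pairing. -/

theorem norm_toLp_sq {α : Type*} [MeasurableSpace α] {μ : Measure α} {w : α → E}
    (hw : MemLp w 2 μ) : ‖hw.toLp w‖ ^ 2 = ∫ t, ‖w t‖ ^ 2 ∂μ := by
  have h1 : (⟪hw.toLp w, hw.toLp w⟫_ℂ).re = ‖hw.toLp w‖ ^ 2 := by
    simpa using re_inner_real_smul_self 1 (hw.toLp w)
  have h2 : ⟪hw.toLp w, hw.toLp w⟫_ℂ = ∫ t, ((‖w t‖ ^ 2 : ℝ) : ℂ) ∂μ := by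
    rw [L2.inner_def]
    refine integral_congr_ae (hw.coeFn_toLp.mono fun t ht => ?_)
    simp only [ht]
    rw [inner_self_eq_norm_sq_to_K]
    simp
  rw [← h1, h2, integral_complex_ofReal, Complex.ofReal_re]

/-- Closedness of the multiplication operator on `L²` induced by a closed operator `S`. -/
theorem memLp_eval_of_tendsto [CompleteSpace E] {α : Type*} [MeasurableSpace α] {μ : Measure α}
    {S : E →ₗ.[ℂ] E} (hS : IsClosed (S.graph : Set (E × E))) {z w : ℕ → α → E} {x : α → E}
    (hw : ∀ n, MemLp (w n) 2 μ) {γ : ℕ × ℕ → ℝ} (hγ : Tendsto γ atTop (𝓝 0))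
    (hwγ : ∀ p : ℕ × ℕ, ∫ t, ‖w p.1 t - w p.2 t‖ ^ 2 ∂μ ≤ γ p)
    (hgraph : ∀ n, ∀ᵐ t ∂μ, (z n t, w n t) ∈ S.graph)
    (hz : ∀ᵐ t ∂μ, Tendsto (fun n => z n t) atTop (𝓝 (x t))) :
    (∀ᵐ t ∂μ, x t ∈ S.domain) ∧ MemLp (fun t => eval S (x t)) 2 μ ∧
      Tendsto (fun n => ∫ t, ‖w n t‖ ^ 2 ∂μ) atTop (𝓝 (∫ t, ‖eval S (x t)‖ ^ 2 ∂μ)) := by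
  have hc : CauchySeq fun n => (hw n).toLp (w n) := by
    rw [cauchySeq_iff_tendsto_dist_atTop_0]
    have h1 := hγ.sqrt
    rw [Real.sqrt_zero] at h1
    refine squeeze_zero (fun _ => dist_nonneg) (fun p => ?_) h1
    refine Real.le_sqrt_of_sq_le ?_
    rw [dist_eq_norm, ← MemLp.toLp_sub, norm_toLp_sq]
    exact hwγ p
  obtain ⟨W, hW⟩ := cauchySeq_tendsto_of_complete hc
  -- Almost everywhere convergence holds only along a subsequence, which is enough to apply
  -- closedness of the graph pointwise in `t`.
  obtain ⟨φ, hφ, hae⟩ := (tendstoInMeasure_of_tendsto_Lp hW).exists_seq_tendsto_ae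
  have hmem : ∀ᵐ t ∂μ, (x t, W t) ∈ S.graph := by
    filter_upwards [hae, hz, ae_all_iff.2 hgraph, ae_all_iff.2 fun n => (hw n).coeFn_toLp]
      with t h1 h2 h3 h4
    simp only [h4] at h1
    exact hS.mem_of_tendsto ((h2.comp hφ.tendsto_atTop).prodMk_nhds h1)
      (Eventually.of_forall fun n => h3 (φ n))
  have heval : (fun t => eval S (x t)) =ᵐ[μ] W := hmem.mono fun t ht => eval_eq_of_mem_graph ht
  have hmemLp : MemLp (fun t => eval S (x t)) 2 μ := (memLp_congr_ae heval).2 (Lp.memLp W)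
  refine ⟨hmem.mono fun t ht => LinearPMap.mem_domain_of_mem_graph ht, hmemLp, ?_⟩
  have hWe : W = hmemLp.toLp _ := by
    refine Lp.ext ?_
    exact heval.symm.trans hmemLp.coeFn_toLp.symm
  have h1 := hW.norm.pow 2
  rw [hWe, norm_toLp_sq] at h1
  simpa only [norm_toLp_sq] using h1

theorem abs_re_inner_le {f x : E} {C : ℝ} (hx : ‖x‖ ≤ C) : |(⟪f, x⟫_ℂ).re| ≤ C * ‖f‖ := by
  have h1 : |(⟪f, x⟫_ℂ).re| ≤ ‖f‖ * ‖x‖ :=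
    (Complex.abs_re_le_norm _).trans (norm_inner_le_norm _ _)
  nlinarith [norm_nonneg f]

theorem integrable_re_inner {α : Type*} [MeasurableSpace α] {μ : Measure α} {f x : α → E}
    (hf : Integrable f μ) (hx : AEStronglyMeasurable x μ) {C : ℝ} (hC : ∀ᵐ t ∂μ, ‖x t‖ ≤ C) :
    Integrable (fun t => (⟪f t, x t⟫_ℂ).re) μ := by
  refine Integrable.mono' (hf.norm.const_mul C) ?_ ?_
  · exact Complex.continuous_re.comp_aestronglyMeasurable
      (AEStronglyMeasurable.inner (𝕜 := ℂ) hf.aestronglyMeasurable hx)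
  · filter_upwards [hC] with t ht
    exact abs_re_inner_le ht

/-- Convergence of the pairing when `g n → f` in `L¹` and `z n → x` boundedly a.e. -/
theorem tendsto_integral_re_inner {α : Type*} [MeasurableSpace α] {μ : Measure α}
    {f x : α → E} {g z : ℕ → α → E} (hf : Integrable f μ) (hg : ∀ n, Integrable (g n) μ)
    (hgf : Tendsto (fun n => ∫ t, ‖g n t - f t‖ ∂μ) atTop (𝓝 0))
    (hz : ∀ n, AEStronglyMeasurable (z n) μ) {C : ℝ} (hC : ∀ n, ∀ᵐ t ∂μ, ‖z n t‖ ≤ C)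
    (hzx : ∀ᵐ t ∂μ, Tendsto (fun n => z n t) atTop (𝓝 (x t))) :
    Tendsto (fun n => ∫ t, (⟪g n t, z n t⟫_ℂ).re ∂μ) atTop (𝓝 (∫ t, (⟪f t, x t⟫_ℂ).re ∂μ)) := by
  have h1 : Tendsto (fun n => ∫ t, (⟪g n t - f t, z n t⟫_ℂ).re ∂μ) atTop (𝓝 0) := by
    have h2 := hgf.const_mul C
    rw [mul_zero] at h2
    refine squeeze_zero_norm (fun n => ?_) h2
    rw [← integral_const_mul]
    refine norm_integral_le_of_norm_le (((hg n).sub hf).norm.const_mul C) ?_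
    filter_upwards [hC n] with t ht
    exact abs_re_inner_le ht
  have h2 : Tendsto (fun n => ∫ t, (⟪f t, z n t⟫_ℂ).re ∂μ) atTop
      (𝓝 (∫ t, (⟪f t, x t⟫_ℂ).re ∂μ)) := by
    refine tendsto_integral_of_dominated_convergence (fun t => C * ‖f t‖)
      (fun n => (integrable_re_inner hf (hz n) (hC n)).aestronglyMeasurable)
      (hf.norm.const_mul C) (fun n => ?_) ?_
    · filter_upwards [hC n] with t ht
      exact abs_re_inner_le ht
    · filter_upwards [hzx] with t ht
      exact (Complex.continuous_re.tendsto _).comp (tendsto_const_nhds.inner ht)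
  have h3 := h1.add h2
  rw [zero_add] at h3
  refine h3.congr fun n => ?_
  have h4 : Integrable (fun t => (⟪g n t - f t, z n t⟫_ℂ).re) μ :=
    integrable_re_inner ((hg n).sub hf) (hz n) (hC n)
  rw [← integral_add h4 (integrable_re_inner hf (hz n) (hC n))]
  refine integral_congr_ae (Eventually.of_forall fun t => ?_)
  simp only
  rw [← Complex.add_re, ← inner_add_left, sub_add_cancel]

/-! ### Energy balance for mild solutions. -/

/-- Dissipation equality for mild solutions. -/
theorem IsContractionSemigroup.energy_duhamel [CompleteSpace E] {𝒯 : ℝ → E →L[ℂ] E}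
    (h𝒯 : IsContractionSemigroup 𝒯) {A S : E →ₗ.[ℂ] E} (hA : IsGenerator A 𝒯)
    (hdis : IsDissipative A) (hd : Dense (A.domain : Set E)) {lam : ℕ → ℝ}
    (hpos : ∀ k, 0 < lam k) (hlam : Tendsto lam atTop atTop) {G : ℕ → E →L[ℂ] E}
    (hG : ∀ k, IsResolvent A (lam k) (G k)) (hS : IsDissipationRoot A S)
    (hSc : IsClosed (S.graph : Set (E × E))) {T : ℝ} (hT : 0 ≤ T) (x₀ : E) {f : ℝ → E}
    (hf : IntegrableOn f (Ioc 0 T)) :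
    (∀ᵐ t ∂volume.restrict (Ioc 0 T), duhamel 𝒯 x₀ f t ∈ S.domain) ∧
      MemLp (fun t => eval S (duhamel 𝒯 x₀ f t)) 2 (volume.restrict (Ioc 0 T)) ∧
      IntervalIntegrable (fun t => (⟪f t, duhamel 𝒯 x₀ f t⟫_ℂ).re) volume 0 T ∧
      ∫ t in (0 : ℝ)..T, (⟪f t, duhamel 𝒯 x₀ f t⟫_ℂ).re =
        hamiltonian (duhamel 𝒯 x₀ f T) - hamiltonian (duhamel 𝒯 x₀ f 0) +
          ∫ t in (0 : ℝ)..T, ‖eval S (duhamel 𝒯 x₀ f t)‖ ^ 2 := by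
  set μ := volume.restrict (Ioc (0 : ℝ) T) with hμ
  have hμmem : ∀ᵐ t ∂μ, t ∈ Ioc 0 T := ae_restrict_mem measurableSet_Ioc
  have hsub : Ioc 0 T ⊆ Ici (0 : ℝ) := fun t ht => ht.1.le
  have hG1 : ∀ n v, ‖(lam n : ℂ) • G n v‖ ≤ ‖v‖ := fun n v => by
    rw [norm_smul, Complex.norm_real, Real.norm_of_nonneg (hpos n).le]
    exact (hG n).norm_apply_le hdis (hpos n).le v
  have hGlim := tendsto_resolvent hdis hd hpos hlam hG
  -- Regularity of the measure gives density of continuous compactly supported functions in `L¹`,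
  -- used to choose `F n`.
  have : μ.Regular := Measure.Regular.restrict_of_measure_ne_top (by simp)
  choose F _ hF hFc hFi using fun n : ℕ =>
    Integrable.exists_hasCompactSupport_integral_sub_le hf
      (Nat.one_div_pos_of_nat (α := ℝ) (n := n))
  set x := duhamel 𝒯 x₀ f with hx
  set y : ℕ → ℝ → E := fun n => duhamel 𝒯 x₀ (F n) with hy
  set z : ℕ → ℝ → E := fun n t => (lam n : ℂ) • G n (y n t) with hz
  set g : ℕ → ℝ → E := fun n t => (lam n : ℂ) • G n (F n t) with hg
  have hFlim : Tendsto (fun n => ∫ t, ‖f t - F n t‖ ∂μ) atTop (𝓝 0) :=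
    squeeze_zero (fun n => integral_nonneg fun t => norm_nonneg _) hF
      tendsto_one_div_add_atTop_nhds_zero_nat
  have hfn : Integrable (fun t => ‖f t‖) μ := hf.norm
  have hfF : ∀ n, Integrable (fun t => ‖f t - F n t‖) μ := fun n => (hf.sub (hFi n)).norm
  have hreg : ∀ n, IsRegularSolution A (z n) (fun t => yosida (lam n) (G n) (y n t)) (g n) :=
    fun n => h𝒯.isRegularSolution hA (hG n) x₀ (hFc n)
  have hyx : ∀ t ∈ Icc 0 T, Tendsto (fun n => y n t) atTop (𝓝 (x t)) := fun t ht => by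
    rw [tendsto_iff_norm_sub_tendsto_zero]
    refine squeeze_zero (fun n => norm_nonneg _) (fun n => ?_) hFlim
    rw [norm_sub_rev]
    exact h𝒯.norm_duhamel_sub_le x₀ hf (hFi n) ht
  have hzx : ∀ t ∈ Icc 0 T, Tendsto (fun n => z n t) atTop (𝓝 (x t)) := fun t ht => by
    have h1 : Tendsto (fun n => (lam n : ℂ) • G n (y n t - x t)) atTop (𝓝 0) :=
      squeeze_zero_norm (fun n => hG1 n _) (tendsto_iff_norm_sub_tendsto_zero.1 (hyx t ht))
    have h2 := h1.add (hGlim (x t))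
    rw [zero_add] at h2
    refine h2.congr fun n => ?_
    rw [map_sub, smul_sub, sub_add_cancel]
  have hzx' : ∀ᵐ t ∂μ, Tendsto (fun n => z n t) atTop (𝓝 (x t)) :=
    hμmem.mono fun t ht => hzx t (Ioc_subset_Icc_self ht)
  -- The summand `1` absorbs the approximation error `1 / (n + 1)`, so `C` bounds every `z n`
  -- uniformly.
  set C := ‖x₀‖ + (∫ t, ‖f t‖ ∂μ + 1) with hC
  have hzC : ∀ n, ∀ t ∈ Icc 0 T, ‖z n t‖ ≤ C := fun n t ht => by
    refine (hG1 n _).trans ((h𝒯.norm_duhamel_le x₀ (hFi n) ht).trans ?_)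
    have h1 : ∫ t, ‖F n t‖ ∂μ ≤ ∫ t, (‖f t‖ + ‖f t - F n t‖) ∂μ := by
      refine integral_mono (hFi n).norm (hfn.add (hfF n)) fun t => ?_
      have := norm_sub_le (f t) (f t - F n t)
      rwa [sub_sub_cancel] at this
    rw [integral_add hfn (hfF n)] at h1
    have h2 : 1 / ((n : ℝ) + 1) ≤ 1 := by
      rw [div_le_one (by positivity)]; simp
    rw [hC]
    linarith [hF n]
  have hzC' : ∀ n, ∀ᵐ t ∂μ, ‖z n t‖ ≤ C := fun n =>
    hμmem.mono fun t ht => hzC n t (Ioc_subset_Icc_self ht)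
  have hzm : ∀ n, AEStronglyMeasurable (z n) μ := fun n =>
    ((hreg n).continuousOn.mono hsub).aestronglyMeasurable measurableSet_Ioc
  have hxm : AEStronglyMeasurable x μ := aestronglyMeasurable_of_tendsto_ae atTop hzm hzx'
  have hxC : ∀ᵐ t ∂μ, ‖x t‖ ≤ C := by
    filter_upwards [hzx', hμmem] with t h1 h2
    exact le_of_tendsto h1.norm
      (Eventually.of_forall fun n => hzC n t (Ioc_subset_Icc_self h2))
  have hgi : ∀ n, Integrable (g n) μ := fun n =>
    ((lam n : ℂ) • G n).integrable_comp (hFi n)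
  have hgfi : ∀ n, Integrable (fun t => ‖g n t - f t‖) μ := fun n => ((hgi n).sub hf).norm
  have hgf : Tendsto (fun n => ∫ t, ‖g n t - f t‖ ∂μ) atTop (𝓝 0) := by
    have hGf : ∀ n, Integrable (fun t => (lam n : ℂ) • G n (f t)) μ := fun n =>
      ((lam n : ℂ) • G n).integrable_comp hf
    have hGff : ∀ n, Integrable (fun t => ‖(lam n : ℂ) • G n (f t) - f t‖) μ := fun n =>
      ((hGf n).sub hf).norm
    have h1 : Tendsto (fun n => ∫ t, ‖(lam n : ℂ) • G n (f t) - f t‖ ∂μ) atTop (𝓝 0) := by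
      have h2 := tendsto_integral_of_dominated_convergence (μ := μ) (f := fun _ => (0 : ℝ))
        (F := fun n t => ‖(lam n : ℂ) • G n (f t) - f t‖) (fun t => 2 * ‖f t‖)
        (fun n => (hGff n).aestronglyMeasurable) (hfn.const_mul 2)
        (fun n => Eventually.of_forall fun t => by
          rw [norm_norm]
          linarith [norm_sub_le ((lam n : ℂ) • G n (f t)) (f t), hG1 n (f t)])
        (Eventually.of_forall fun t => tendsto_iff_norm_sub_tendsto_zero.1 (hGlim (f t)))
      simpa using h2
    have h3 := hFlim.add h1
    rw [zero_add] at h3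
    refine squeeze_zero (fun n => integral_nonneg fun t => norm_nonneg _) (fun n => ?_) h3
    rw [← integral_add (hfF n) (hGff n)]
    refine integral_mono (hgfi n) ((hfF n).add (hGff n)) fun t => ?_
    have h4 : g n t - f t =
        (lam n : ℂ) • G n (F n t - f t) + ((lam n : ℂ) • G n (f t) - f t) := by
      rw [hg, map_sub, smul_sub]; abel
    have h5 := hG1 n (F n t - f t)
    rw [norm_sub_rev (F n t)] at h5
    simp only [h4]
    exact (norm_add_le _ _).trans (by simpa using h5)
  have hw : ∀ n, ContinuousOn (fun t => eval S (z n t)) (Ici 0) := fun n =>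
    (hreg n).continuousOn_eval hS
  have hwLp : ∀ n, MemLp (fun t => eval S (z n t)) 2 μ := fun n => by
    have h1 : ContinuousOn (fun t => eval S (z n t)) (Icc 0 T) := (hw n).mono Icc_subset_Ici_self
    obtain ⟨K, hK⟩ := isCompact_Icc.exists_bound_of_continuousOn h1
    refine MemLp.of_bound (((hw n).mono hsub).aestronglyMeasurable measurableSet_Ioc) K ?_
    exact hμmem.mono fun t ht => hK t (Ioc_subset_Icc_self ht)
  set α : ℕ → ℝ := fun n => ‖z n 0 - x 0‖ with hα
  set β : ℕ → ℝ := fun n => ∫ t, ‖g n t - f t‖ ∂μ with hβ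
  have hα0 : Tendsto α atTop (𝓝 0) :=
    tendsto_iff_norm_sub_tendsto_zero.1 (hzx 0 ⟨le_rfl, hT⟩)
  -- The two terms bound the initial energy of `z n - z m` and the work of `g n - g m` on it; the
  -- final energy has the favourable sign and is dropped.
  have hγ : Tendsto (fun p : ℕ × ℕ => 1 / 2 * (α p.1 + α p.2) ^ 2 + 2 * C * (β p.1 + β p.2)) atTop
      (𝓝 0) := by
    rw [← prod_atTop_atTop_eq]
    have h1 := ((hα0.comp tendsto_fst).add (hα0.comp tendsto_snd) :
      Tendsto _ (atTop ×ˢ atTop : Filter (ℕ × ℕ)) _)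
    have h2 := ((hgf.comp tendsto_fst).add (hgf.comp tendsto_snd) :
      Tendsto _ (atTop ×ˢ atTop : Filter (ℕ × ℕ)) _)
    have h3 := ((h1.pow 2).const_mul (1 / 2)).add (h2.const_mul (2 * C))
    simpa using h3
  have hcauchy : ∀ p : ℕ × ℕ, ∫ t, ‖eval S (z p.1 t) - eval S (z p.2 t)‖ ^ 2 ∂μ ≤
      1 / 2 * (α p.1 + α p.2) ^ 2 + 2 * C * (β p.1 + β p.2) := by
    rintro ⟨n, m⟩
    have h1 := ((hreg n).sub (hreg m)).energy hS hT
    rw [intervalIntegral.integral_of_le hT, intervalIntegral.integral_of_le hT] at h1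
    have h2 : ∫ t, ‖eval S (z n t - z m t)‖ ^ 2 ∂μ =
        ∫ t, ‖eval S (z n t) - eval S (z m t)‖ ^ 2 ∂μ := by
      refine integral_congr_ae (hμmem.mono fun t ht => ?_)
      simp only
      rw [hS.eval_sub ((hreg n).mem_graph t ht.1.le) ((hreg m).mem_graph t ht.1.le)]
    have h3 : hamiltonian (z n 0 - z m 0) ≤ 1 / 2 * (α n + α m) ^ 2 := by
      have h4 := norm_sub_le (z n 0 - x 0) (z m 0 - x 0)
      rw [sub_sub_sub_cancel_right] at h4
      rw [hamiltonian]
      gcongr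
    have h4 : 0 ≤ hamiltonian (z n T - z m T) := by rw [hamiltonian]; positivity
    have h5 : ∫ t, (⟪g n t - g m t, z n t - z m t⟫_ℂ).re ∂μ ≤ 2 * C * (β n + β m) := by
      rw [hβ]
      beta_reduce
      rw [← integral_add (hgfi n) (hgfi m), ← integral_const_mul]
      have hb : ∀ᵐ t ∂μ, ‖z n t - z m t‖ ≤ 2 * C := by
        filter_upwards [hzC' n, hzC' m] with t h6 h7
        linarith [norm_sub_le (z n t) (z m t)]
      refine integral_mono_ae (integrable_re_inner ((hgi n).sub (hgi m)) ((hzm n).sub (hzm m)) hb)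
        (((hgfi n).add (hgfi m)).const_mul _) ?_
      filter_upwards [hb] with t ht
      have h6 := norm_sub_le (g n t - f t) (g m t - f t)
      rw [sub_sub_sub_cancel_right] at h6
      refine ((le_abs_self _).trans (abs_re_inner_le ht)).trans ?_
      have hC0 : 0 ≤ 2 * C := (norm_nonneg _).trans ht
      exact mul_le_mul_of_nonneg_left h6 hC0
    simp only
    rw [← h2]
    linarith
  obtain ⟨hdom, hLp, hlimS⟩ := memLp_eval_of_tendsto hSc hwLp hγ hcauchy
    (fun n => hμmem.mono fun t ht => (hS _ _ ((hreg n).mem_graph t ht.1.le)).1) hzx'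
  refine ⟨hdom, hLp, ?_, ?_⟩
  · rw [intervalIntegrable_iff_integrableOn_Ioc_of_le hT]
    exact integrable_re_inner hf hxm hxC
  · rw [intervalIntegral.integral_of_le hT, intervalIntegral.integral_of_le hT]
    have hH : ∀ t ∈ Icc 0 T, Tendsto (fun n => hamiltonian (z n t)) atTop (𝓝 (hamiltonian (x t))) :=
      fun t ht => ((hzx t ht).norm.pow 2).const_mul _
    refine tendsto_nhds_unique (tendsto_integral_re_inner hf hgi hgf hzm hzC' hzx') ?_
    refine (((hH T ⟨hT, le_rfl⟩).sub (hH 0 ⟨le_rfl, hT⟩)).add hlimS).congr fun n => ?_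
    have h1 := (hreg n).energy hS hT
    rw [intervalIntegral.integral_of_le hT, intervalIntegral.integral_of_le hT] at h1
    exact h1.symm

/-! ### The semigroup generated by `J - R` and the theorem. -/

theorem isContractionSemigroup_semigroup [CompleteSpace E] {A : E →ₗ.[ℂ] E}
    (hdis : IsDissipative A) (hd : Dense (A.domain : Set E)) {lam : ℕ → ℝ}
    (hpos : ∀ k, 0 < lam k) (hlam : Tendsto lam atTop atTop) {G : ℕ → E →L[ℂ] E}
    (hG : ∀ k, IsResolvent A (lam k) (G k)) :
    IsContractionSemigroup (semigroup A) ∧ IsGenerator A (semigroup A) := by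
  have h : IsC0Semigroup (semigroup A) ∧ IsGenerator A (semigroup A) :=
    Classical.epsilon_spec (exists_isC0Semigroup hdis hd hpos hlam hG)
  exact ⟨⟨h.1, fun t ht v => h.2.norm_apply_le h.1 hdis hd ht v⟩, h.2⟩

end PortHamiltonian

end

theorem proposition2p2 {E : Type*} [NormedAddCommGroup E] [InnerProductSpace ℂ E]
    [CompleteSpace E] [TopologicalSpace.SeparableSpace E]
    (J R : E →ₗ.[ℂ] E) (hJ : IsSkewAdjoint J) (hR : IsNonnegSelfAdjoint R)
    (hJR : IsRelBoundedLTOne J R ∨ IsRelBoundedLTOne R J)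
    {m : ℕ} (B : EuclideanSpace ℂ (Fin m) →L[ℂ] E) (T : ℝ) (hT : 0 < T) :
    -- the square root of `R` and the contraction semigroup generated by `J - R` exist
    IsPosSqrt R (posSqrt R) ∧
    (IsC0Semigroup (semigroup (J - R)) ∧ IsGenerator (J - R) (semigroup (J - R)) ∧
      ∀ t : ℝ, 0 ≤ t → ‖semigroup (J - R) t‖ ≤ 1) ∧
    -- regularity and dissipation equality for mild solutions
    (∀ (x₀ : E) (u : ℝ → EuclideanSpace ℂ (Fin m)), IntegrableOn u (Ioc 0 T) →
      (∀ᵐ t ∂volume.restrict (Ioc 0 T),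
        mildSolution (J - R) B x₀ u t ∈ (posSqrt R).domain) ∧
      MemLp (fun t => eval (posSqrt R) (mildSolution (J - R) B x₀ u t)) 2
        (volume.restrict (Ioc 0 T)) ∧
      IntervalIntegrable (fun t => (⟪B (u t), mildSolution (J - R) B x₀ u t⟫_ℂ).re)
        volume 0 T ∧
      ∫ t in (0 : ℝ)..T, (⟪B (u t), mildSolution (J - R) B x₀ u t⟫_ℂ).re =
        hamiltonian (mildSolution (J - R) B x₀ u T) -
            hamiltonian (mildSolution (J - R) B x₀ u 0) +
          ∫ t in (0 : ℝ)..T, ‖eval (posSqrt R) (mildSolution (J - R) B x₀ u t)‖ ^ 2) ∧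
    -- the uncontrolled case
    (∀ x₀ : E,
      (∀ᵐ t ∂volume.restrict (Ioi (0 : ℝ)), semigroup (J - R) t x₀ ∈ (posSqrt R).domain) ∧
      MemLp (fun t => eval (posSqrt R) (semigroup (J - R) t x₀)) 2
        (volume.restrict (Ioc 0 T))) := by
  have hS := isPosSqrt_posSqrt hR
  have hdis := isDissipative_sub hJ hR
  have hd := dense_domain_sub hJ hR hJR
  obtain ⟨l₀, hl₀, hres⟩ := exists_isResolvent_sub hJ hR hJR
  have hpos : ∀ k : ℕ, 0 < l₀ + k := fun k => by positivity
  have hlam : Tendsto (fun k : ℕ => l₀ + k) atTop atTop :=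
    tendsto_atTop_add_const_left _ _ tendsto_natCast_atTop_atTop
  choose G hG using fun k : ℕ => hres (l₀ + k) (by simp)
  obtain ⟨h𝒯, hgen⟩ := isContractionSemigroup_semigroup hdis hd hpos hlam hG
  -- The horizon is left free: the almost everywhere statement on the half-line follows by covering
  -- it with the intervals `(0, n]`.
  have henergy : ∀ T' : ℝ, 0 ≤ T' → ∀ (x₀ : E) (f : ℝ → E), IntegrableOn f (Ioc 0 T') → _ :=
    fun T' hT' x₀ f hf => h𝒯.energy_duhamel hgen hdis hd hpos hlam hG
      (isDissipationRoot_sub hJ hS) hS.1.isClosed_graph hT' x₀ hf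
  have hfree : ∀ x₀ : E, duhamel (semigroup (J - R)) x₀ (fun _ => 0) =
      fun t => semigroup (J - R) t x₀ := fun x₀ => by
    funext t; simp [duhamel]
  refine ⟨hS, ⟨h𝒯.toIsC0Semigroup, hgen, fun t ht => ?_⟩, fun x₀ u hu => ?_, fun x₀ => ⟨?_, ?_⟩⟩
  · refine ContinuousLinearMap.opNorm_le_bound _ zero_le_one fun v => ?_
    rw [one_mul]
    exact h𝒯.norm_apply_le t ht v
  · exact henergy T hT.le x₀ (fun t => B (u t)) (B.integrable_comp hu)
  · have h1 : Ioi (0 : ℝ) = ⋃ n : ℕ, Ioc 0 (n : ℝ) := by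
      ext t
      simp only [mem_Ioi, mem_iUnion, mem_Ioc]
      exact ⟨fun h => (exists_nat_ge t).imp fun n hn => ⟨h, hn⟩, fun ⟨n, h⟩ => h.1⟩
    rw [h1, ae_restrict_iUnion_iff]
    intro n
    have h2 := (henergy n n.cast_nonneg x₀ (fun _ => 0) (by simp)).1
    simpa only [hfree] using h2
  · have h2 := (henergy T hT.le x₀ (fun _ => 0) (by simp)).2.1
    simpa only [hfree] using h2
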